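/- Let $I$ be a non-empty finite alphabet, $\Sigma=I^{\mathbb N}$ with the left shift $\sigma$ and the metric $d(\omega,\tau)=\exp(-\max\{k\ge 0:\omega_1=\tau_1,\dots,\omega_k=\tau_k\})$, and let $f,\psi:\Sigma\to\mathbb R$ be Hölder continuous. Write $S_nf=\sum_{k=0}^{n-1}f\circ\sigma^k$ and, for a finite word $\omega$ of length $|\omega|$ with cylinder $[\omega]\subset\Sigma$, $S_\omega f=\sup_{x\in[\omega]}S_{|\omega|}f(x)$. For non-empty $J\subset I$ let $$\mathfrak P(f,J)=\lim_{n\to\infty}\frac1n\log\sum_{\omega\in J^n}e^{S_\omega f},\qquad \mathfrak P(f)=\mathfrak P(f,I),$$ and let $\mu_f$ be the unique $\sigma$-invariant Borel probability measure on $\Sigma$ for which there is $c\ge1$ with $c^{-1}\le \mu_f([\omega])/e^{S_nf(x)-n\mathfrak P(f)}\le c$ for all $n$, all words $\omega$ of length $n$ and all $x\in[\omega]$ (the Gibbs measure of $f$). Put $$\underline\psi=\inf_{\omega\in\Sigma}\liminf_{n\to\infty}\tfrac1nS_n\psi(\omega),\qquad \overline\psi=\sup_{\omega\in\Sigma}\limsup_{n\to\infty}\tfrac1nS_n\psi(\omega).$$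 Let $D_\psi$ be a constant with $|S_n\psi(x)-S_n\psi(y)|\le D_\psi$ for all $n$, all words $\omega$ of length $n$ and all $x,y\in[\omega]$. For $K>0$ let $\mathcal C_n(K)$ be the set of words $\omega$ of length $n$ with $|S_\omega\psi|\le K$, let $\mathcal C(K)=\bigcup_{n\ge1}\mathcal C_n(K)$, and define the fibre-induced pressure by $$\mathcal P(f,\psi,K)=\limsup_{n\to\infty}\frac1n\log\sum_{\omega\in\mathcal C_n(K)}e^{S_\omega f}\in[-\infty,\infty],\qquad \mathcal P(f,\psi)=\lim_{K\to\infty}\mathcal P(f,\psi,K),$$ with $\log 0=-\infty$. Fix $K>D_\psi$. Then the following hold. 1. If $0\in(\underline\psi,\overline\psi)$, then (the Gibbs measures $\mu_{s\psi+f}$, $s\in\mathbb R$, exist and are unique, and) there is a unique $t(f)\in\mathbb R$ with $\int\psi\,d\mu_{t(f)\psi+f}=0$, and $$\mathcal P(f,\psi,K)=\mathfrak P(t(f)\psi+f)=\min_{s\in\mathbb R}\mathfrak P(s\psi+f).$$ 2. If $\psi$ is constant on one-cylinder sets (with no assumption on the position of $0$), then $$\mathcal P(f,\psi,K)=\inf_{s\in\mathbb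 R}\mathfrak P(s\psi+f)\in[-\infty,\infty),$$ and $\mathcal P(f,\psi,K)$ is finite if and only if $0\in[\underline\psi,\overline\psi]$; likewise $\mathcal P(f,\psi)$ is finite if and only if $0\in[\underline\psi,\overline\psi]$. 3. If $\psi$ is constant on one-cylinder sets and $0\in\{\underline\psi,\overline\psi\}$, then $I_0=\{i\in I:\psi=0\text{ on }[i]\}$ is non-empty and $\mathcal P(f,\psi,K)=\mathfrak P(f,I_0)$. 4. If $0\in(\underline\psi,\overline\psi)$, or if $\psi$ is constant on one-cylinder sets and $0\in[\underline\psi,\overline\psi]$, then $\mathcal P(f,\psi,K)$ is finite and $$\sum_{\omega\in\mathcal C(K)}e^{S_\omega f-|\omega|\,\mathcal P(f,\psi,K)}=\infty .$$ -/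

import Mathlib

open Filter Topology MeasureTheory

noncomputable section

namespace FibrePressure

variable {I : Type*}

/-- The left shift on the full shift space `ℕ → I` (coordinates are indexed from `0`). -/
def shift (x : ℕ → I) : ℕ → I := fun n => x (n + 1)

open Classical in
/-- The metric `d(x, y) = exp (- max {k | the first k symbols of x and y agree})`,
with `d(x, x) = 0`.  For `x ≠ y`, `PiNat.firstDiff x y` is the first index at which `x` and `y`
differ, that is, the number of initial symbols on which they agree. -/
def codeDist (x y : ℕ → I) : ℝ :=
  if x = y then 0 else Real.exp (-(PiNat.firstDiff x y : ℝ))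

/-- Hölder continuity with respect to `codeDist`. -/
def IsHolder (f : (ℕ → I) → ℝ) : Prop :=
  ∃ a : ℝ, 0 < a ∧ ∃ C : ℝ, ∀ x y, |f x - f y| ≤ C * codeDist x y ^ a

/-- The cylinder set `[ω]` of a finite word `ω` of length `n`. -/
def cylinder {n : ℕ} (ω : Fin n → I) : Set (ℕ → I) :=
  {x | ∀ k : Fin n, x k = ω k}

/-- `S_ω f = sup_{x ∈ [ω]} S_n f (x)`, where `n` is the length of `ω` and
`S_n f = ∑_{k < n} f ∘ shift^k`. -/
def supSum (f : (ℕ → I) → ℝ) {n : ℕ} (ω : Fin n → I) : ℝ :=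
  ⨆ x : cylinder ω, birkhoffSum shift f n (x : ℕ → I)

/-- `D` is a distortion constant of `f`: the Birkhoff sums `S_n f` vary by at most `D` on each
cylinder of length `n`. -/
def IsDistortionConst (f : (ℕ → I) → ℝ) (D : ℝ) : Prop :=
  ∀ (n : ℕ) (ω : Fin n → I), ∀ x ∈ cylinder ω, ∀ y ∈ cylinder ω,
    |birkhoffSum shift f n x - birkhoffSum shift f n y| ≤ D

/-- `f` is constant on one-cylinder sets. -/
def ConstOnOneCylinders (f : (ℕ → I) → ℝ) : Prop :=
  ∀ x y : ℕ → I, x 0 = y 0 → f x = f y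

/-- The infimum over all points of the lower Birkhoff averages. -/
def lowerAvg (ψ : (ℕ → I) → ℝ) : ℝ :=
  ⨅ x : ℕ → I, liminf (fun n : ℕ => birkhoffSum shift ψ n x / n) atTop

/-- The supremum over all points of the upper Birkhoff averages. -/
def upperAvg (ψ : (ℕ → I) → ℝ) : ℝ :=
  ⨆ x : ℕ → I, limsup (fun n : ℕ => birkhoffSum shift ψ n x / n) atTop

/-- The symbols `i` such that `ψ` vanishes on the one-cylinder `[i]`. -/
def zeroSymbols (ψ : (ℕ → I) → ℝ) : Set I :=
  {i | ∀ x : ℕ → I, x 0 = i → ψ x = 0}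

section Pressure

variable [Fintype I]

open Classical in
/-- `∑_{ω ∈ J^n} exp (S_ω f)`. -/
def partitionSum (f : (ℕ → I) → ℝ) (J : Set I) (n : ℕ) : ℝ :=
  ∑ ω : Fin n → I with ∀ k, ω k ∈ J, Real.exp (supSum f ω)

/-- The classical topological pressure of `f` on the subalphabet `J`,
`lim_n (1/n) log ∑_{ω ∈ J^n} exp (S_ω f)`.  For `f` Hölder continuous and `J` non-empty the limit
exists in `ℝ`, see `tendsto_pressureOn`. -/
def pressureOn (f : (ℕ → I) → ℝ) (J : Set I) : ℝ :=
  limUnder atTop (fun n : ℕ => Real.log (partitionSum f J n) / n)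

/-- The classical topological pressure of `f` on the full shift. -/
def pressure (f : (ℕ → I) → ℝ) : ℝ := pressureOn f Set.univ

/-- `μ` is a shift-invariant Borel probability measure with the Gibbs property for `f`. -/
structure IsGibbsMeasure [MeasurableSpace I] (f : (ℕ → I) → ℝ) (μ : Measure (ℕ → I)) :
    Prop where
  isProbabilityMeasure : IsProbabilityMeasure μ
  invariant : MeasurePreserving shift μ μ
  gibbs : ∃ c : ℝ, 1 ≤ c ∧ ∀ (n : ℕ) (ω : Fin n → I), ∀ x ∈ cylinder ω,
    c⁻¹ ≤ μ.real (cylinder ω) / Real.exp (birkhoffSum shift f n x - n * pressure f) ∧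
    μ.real (cylinder ω) / Real.exp (birkhoffSum shift f n x - n * pressure f) ≤ c

open Classical in
/-- The Gibbs measure `μ_f` of `f` (the zero measure if there is none). -/
def gibbsMeasure [MeasurableSpace I] (f : (ℕ → I) → ℝ) : Measure (ℕ → I) :=
  if h : ∃ μ : Measure (ℕ → I), IsGibbsMeasure f μ then h.choose else 0

open Classical in
/-- `ζ_n(f, ψ, K)`: the sum of `exp (S_ω f)` over the words `ω` of length `n` with
`|S_ω ψ| ≤ K`. -/
def zetaSum (f ψ : (ℕ → I) → ℝ) (K : ℝ) (n : ℕ) : ENNReal :=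
  ∑ ω : Fin n → I with |supSum ψ ω| ≤ K, ENNReal.ofReal (Real.exp (supSum f ω))

/-- The fibre-induced pressure at level `K`, `limsup_n (1/n) log ζ_n(f, ψ, K)`, as an extended
real number (`log 0 = -∞`). -/
def fibrePressureAt (f ψ : (ℕ → I) → ℝ) (K : ℝ) : EReal :=
  limsup (fun n : ℕ => ENNReal.log (zetaSum f ψ K n) / (n : EReal)) atTop

/-- The fibre-induced pressure, the limit as `K → ∞` of `fibrePressureAt f ψ K`; the limit exists
by monotonicity, see `tendsto_fibrePressure`. -/
def fibrePressure (f ψ : (ℕ → I) → ℝ) : EReal :=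
  limUnder atTop (fun K : ℝ => fibrePressureAt f ψ K)

/-- The set of all non-empty finite words `ω` with `|S_ω ψ| ≤ K`. -/
def returnWords (ψ : (ℕ → I) → ℝ) (K : ℝ) : Set (Σ n : ℕ, Fin n → I) :=
  {w | 1 ≤ w.1 ∧ |supSum ψ w.2| ≤ K}

end Pressure

/-! Existence of the limits in the definitions above. -/

theorem codeDist_nonneg (x y : ℕ → I) : 0 ≤ codeDist x y := by
  unfold codeDist; split_ifs <;> positivity

theorem codeDist_le_one (x y : ℕ → I) : codeDist x y ≤ 1 := by
  unfold codeDist; split_ifs <;> simp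

theorem IsHolder.bounded [Nonempty I] {f : (ℕ → I) → ℝ} (hf : IsHolder f) :
    ∃ M : ℝ, 0 ≤ M ∧ ∀ x, |f x| ≤ M := by
  obtain ⟨a, ha, C, hC⟩ := hf
  obtain ⟨i⟩ := ‹Nonempty I›
  refine ⟨|C| + |f fun _ => i|, by positivity, fun x => ?_⟩
  have h1 := hC x (fun _ => i)
  have h2 : codeDist x (fun _ => i) ^ a ≤ 1 :=
    Real.rpow_le_one (codeDist_nonneg _ _) (codeDist_le_one _ _) ha.le
  have h3 : 0 ≤ codeDist x (fun _ => i) ^ a := Real.rpow_nonneg (codeDist_nonneg _ _) _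
  have h4 : C * codeDist x (fun _ => i) ^ a ≤ |C| :=
    (mul_le_mul_of_nonneg_right (le_abs_self C) h3).trans
      (mul_le_of_le_one_right (abs_nonneg C) h2)
  have h5 := abs_sub_abs_le_abs_sub (f x) (f fun _ => i)
  linarith

theorem abs_birkhoffSum_le {f : (ℕ → I) → ℝ} {M : ℝ} (hM : ∀ x, |f x| ≤ M) (n : ℕ)
    (x : ℕ → I) : |birkhoffSum shift f n x| ≤ n * M := by
  unfold birkhoffSum
  refine (Finset.abs_sum_le_sum_abs _ _).trans ?_
  refine (Finset.sum_le_sum (fun k _ => hM _)).trans ?_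
  simp

theorem cylinder_nonempty [Nonempty I] {n : ℕ} (ω : Fin n → I) : (cylinder ω).Nonempty := by
  obtain ⟨i⟩ := ‹Nonempty I›
  refine ⟨fun k => if h : k < n then ω ⟨k, h⟩ else i, fun k => ?_⟩
  simp

theorem bddAbove_birkhoffSum {f : (ℕ → I) → ℝ} {M : ℝ} (hM : ∀ x, |f x| ≤ M) {n : ℕ}
    (ω : Fin n → I) :
    BddAbove (Set.range fun x : cylinder ω => birkhoffSum shift f n (x : ℕ → I)) := by
  refine ⟨n * M, ?_⟩
  rintro _ ⟨x, rfl⟩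
  exact (le_abs_self _).trans (abs_birkhoffSum_le hM n _)

theorem le_supSum {f : (ℕ → I) → ℝ} {M : ℝ} (hM : ∀ x, |f x| ≤ M) {n : ℕ}
    (ω : Fin n → I) {x : ℕ → I} (hx : x ∈ cylinder ω) : birkhoffSum shift f n x ≤ supSum f ω :=
  le_ciSup (bddAbove_birkhoffSum hM ω) (⟨x, hx⟩ : cylinder ω)

theorem shift_iterate (m : ℕ) (x : ℕ → I) (k : ℕ) : (shift^[m] x) k = x (m + k) := by
  induction m generalizing x with
  | zero => simp
  | succ m ih =>
    rw [Function.iterate_succ_apply, ih]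
    simp only [shift]
    congr 1; omega

theorem supSum_append_le [Nonempty I] {f : (ℕ → I) → ℝ} {M : ℝ} (hM : ∀ x, |f x| ≤ M) {m n : ℕ}
    (ω : Fin m → I) (ν : Fin n → I) :
    supSum f (Fin.append ω ν) ≤ supSum f ω + supSum f ν := by
  have : Nonempty (cylinder (Fin.append ω ν)) := (cylinder_nonempty _).to_subtype
  refine ciSup_le ?_
  rintro ⟨x, hx⟩
  have h : birkhoffSum shift f (m + n) x =
      birkhoffSum shift f m x + birkhoffSum shift f n (shift^[m] x) := birkhoffSum_add ..
  simp only [h]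
  refine add_le_add (le_supSum hM ω fun k => ?_) (le_supSum hM ν fun k => ?_)
  · simpa using hx (Fin.castAdd n k)
  · rw [shift_iterate]
    simpa using hx (Fin.natAdd m k)

theorem partitionSum_pos [Fintype I] (f : (ℕ → I) → ℝ) {J : Set I} (hJ : J.Nonempty) (n : ℕ) :
    0 < partitionSum f J n := by
  classical
  obtain ⟨j, hj⟩ := hJ
  refine Finset.sum_pos (fun _ _ => Real.exp_pos _) ⟨fun _ => j, ?_⟩
  simp [hj]

theorem partitionSum_add_le [Fintype I] [Nonempty I] {f : (ℕ → I) → ℝ} {M : ℝ}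
    (hM : ∀ x, |f x| ≤ M) (J : Set I) (m n : ℕ) :
    partitionSum f J (m + n) ≤ partitionSum f J m * partitionSum f J n := by
  classical
  unfold partitionSum
  rw [Finset.sum_mul_sum, ← Finset.sum_product']
  have key : ∑ p ∈ (Finset.univ.filter fun ω : Fin m → I => ∀ k, ω k ∈ J) ×ˢ
        (Finset.univ.filter fun ω : Fin n → I => ∀ k, ω k ∈ J),
        Real.exp (supSum f (Fin.append p.1 p.2)) =
      ∑ ω : Fin (m + n) → I with ∀ k, ω k ∈ J, Real.exp (supSum f ω) := by
    refine Finset.sum_equiv (Fin.appendEquiv m n) ?_ ?_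
    · rintro ⟨ω, ν⟩
      simp only [Finset.mem_product, Finset.mem_filter, Finset.mem_univ, true_and,
        Fin.appendEquiv, Equiv.coe_fn_mk]
      constructor
      · rintro ⟨h1, h2⟩ k
        refine Fin.addCases (fun i => ?_) (fun i => ?_) k
        · simpa using h1 i
        · simpa using h2 i
      · intro h
        exact ⟨fun i => by simpa using h (Fin.castAdd n i),
          fun i => by simpa using h (Fin.natAdd m i)⟩
    · rintro ⟨ω, ν⟩ _
      rfl
  rw [← key]
  refine Finset.sum_le_sum fun p _ => ?_
  rw [← Real.exp_add]
  exact Real.exp_le_exp.2 (supSum_append_le hM _ _)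

/-- The limit defining the classical pressure exists. -/
theorem tendsto_pressureOn [Fintype I] [Nonempty I] {f : (ℕ → I) → ℝ} (hf : IsHolder f)
    {J : Set I} (hJ : J.Nonempty) :
    Tendsto (fun n : ℕ => Real.log (partitionSum f J n) / n) atTop (𝓝 (pressureOn f J)) := by
  classical
  obtain ⟨M, hM0, hM⟩ := hf.bounded
  have hsub : Subadditive (fun n : ℕ => Real.log (partitionSum f J n)) := fun m n => by
    rw [← Real.log_mul (partitionSum_pos f hJ m).ne' (partitionSum_pos f hJ n).ne']
    exact Real.log_le_log (partitionSum_pos f hJ _) (partitionSum_add_le hM J m n)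
  have hbdd : BddBelow (Set.range fun n : ℕ => Real.log (partitionSum f J n) / n) := by
    refine ⟨-M, ?_⟩
    rintro _ ⟨n, rfl⟩
    rcases Nat.eq_zero_or_pos n with rfl | hn
    · simpa using hM0
    obtain ⟨j, hj⟩ := hJ
    have hn' : (0 : ℝ) < n := by exact_mod_cast hn
    have h1 : Real.exp (supSum f fun _ : Fin n => j) ≤ partitionSum f J n := by
      unfold partitionSum
      refine Finset.single_le_sum
        (f := fun ω : Fin n → I => Real.exp (supSum f ω))
        (fun _ _ => (Real.exp_pos _).le) ?_
      simp [hj]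
    have h2 : -(n * M) ≤ supSum f fun _ : Fin n => j :=
      (neg_le_of_abs_le (abs_birkhoffSum_le hM n fun _ => j)).trans
        (le_supSum hM _ fun _ => rfl)
    have h3 : supSum f (fun _ : Fin n => j) ≤ Real.log (partitionSum f J n) := by
      rw [Real.le_log_iff_exp_le (partitionSum_pos f ⟨j, hj⟩ n)]
      exact h1
    show -M ≤ Real.log (partitionSum f J n) / n
    rw [le_div_iff₀ hn']
    linarith
  exact tendsto_nhds_limUnder ⟨_, hsub.tendsto_lim hbdd⟩

theorem fibrePressureAt_mono [Fintype I] (f ψ : (ℕ → I) → ℝ) :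
    Monotone (fibrePressureAt f ψ) := by
  classical
  intro K L hKL
  refine limsup_le_limsup (Eventually.of_forall fun n => ?_)
  refine EReal.monotone_div_right_of_nonneg (by positivity) (ENNReal.log_monotone ?_)
  refine Finset.sum_le_sum_of_subset fun ω hω => ?_
  simp only [Finset.mem_filter, Finset.mem_univ, true_and] at hω ⊢
  exact hω.trans hKL

/-- The limit defining the fibre-induced pressure exists. -/
theorem tendsto_fibrePressure [Fintype I] (f ψ : (ℕ → I) → ℝ) :
    Tendsto (fun K : ℝ => fibrePressureAt f ψ K) atTop (𝓝 (fibrePressure f ψ)) :=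
  tendsto_nhds_limUnder ⟨_, tendsto_atTop_iSup (fibrePressureAt_mono f ψ)⟩

end FibrePressure

end

/-! Write P(s) for the pressure of sψ+f and μ_s for its Gibbs measure.

Upper bound. On a word with |S_ω ψ| ≤ K, replacing f by sψ+f changes S_ω f by a constant that does
not depend on the length. The restricted partition sum is therefore at most a constant times the
full one for sψ+f, and 𝒫(f,ψ,K) ≤ P(s) for every s (`fibrePressureAt_le_pressure`).

Lower bound in the interior case. Jensen's inequality gives P(t) + (s−t)∫ψ dμ_t ≤ P(s)
(`pressure_add_mul_integral_le`), so any zero t of s ↦ ∫ψ dμ_s minimises P. A zero exists because P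
grows at least linearly in |s| and the integral is continuous in s. For such t, the Gibbs bounds
make μ_t(|S_n ψ| ≤ K) comparable to ζ_n e^{−nP(t)}, and it suffices that these probabilities have
infinite sum: this is the divergence in item 4, and the root test turns it into 𝒫 ≥ P(t).

The infinite sum is a recurrence statement of Chung–Fuchs type for the mean-zero sums S_n ψ
(`tsum_measure_visitSet_eq_top`). If it were finite, a first-visit decomposition would bound the
expected number of visits to every interval of length K − D_ψ by a common Q. A range of size ηN
would then receive O(ηNQ) + Q visits up to time N, whereas the weak law of large numbers forces
about N/2.

Uniqueness of t needs no analyticity of P. If two zeros s ≠ t existed, P would agree at s, t and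
their midpoint u, which yields μ_u ≪ μ_s + μ_t. By ergodicity μ_u equals one of these or is singular
to both; equality would make S_n ψ bounded, so both options fail.

If ψ is constant on one-cylinders and 0 is an endpoint of the range of averages, ψ has one sign.
Sending s to the appropriate infinity suppresses all words using a symbol outside I_0, while words
over I_0 satisfy S_ω ψ = 0. If 0 lies outside the range, P(s) is unbounded below. -/

noncomputable section

set_option linter.unusedSectionVars false

namespace FibrePressure

variable {I : Type*}

/-! ### Words and points -/

/-- The word consisting of the first `n` symbols of `x`. -/
def prefixWord (n : ℕ) (x : ℕ → I) : Fin n → I := fun k => x k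

/-- The point that starts with the word `ω` and continues with `x`. -/
def wordCons {n : ℕ} (ω : Fin n → I) (x : ℕ → I) : ℕ → I :=
  fun k => if h : k < n then ω ⟨k, h⟩ else x (k - n)

theorem mem_cylinder_iff {n : ℕ} {ω : Fin n → I} {x : ℕ → I} :
    x ∈ cylinder ω ↔ prefixWord n x = ω :=
  ⟨fun h => funext h, fun h k => congrFun h k⟩

theorem mem_cylinder_prefixWord (n : ℕ) (x : ℕ → I) : x ∈ cylinder (prefixWord n x) :=
  fun _ => rfl

theorem wordCons_mem_cylinder {n : ℕ} (ω : Fin n → I) (x : ℕ → I) :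
    wordCons ω x ∈ cylinder ω := fun k => by simp [wordCons]

@[simp] theorem shift_iterate_wordCons {n : ℕ} (ω : Fin n → I) (x : ℕ → I) :
    shift^[n] (wordCons ω x) = x := by
  funext k
  rw [shift_iterate]
  simp [wordCons]

theorem mem_cylinder_append {m n : ℕ} {ω : Fin m → I} {ν : Fin n → I} {x : ℕ → I} :
    x ∈ cylinder (Fin.append ω ν) ↔ x ∈ cylinder ω ∧ shift^[m] x ∈ cylinder ν := by
  constructor
  · intro hx
    refine ⟨fun k => ?_, fun k => ?_⟩
    · simpa using hx (Fin.castAdd n k)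
    · rw [shift_iterate]
      simpa using hx (Fin.natAdd m k)
  · rintro ⟨h1, h2⟩ k
    refine Fin.addCases (fun i => ?_) (fun i => ?_) k
    · simpa using h1 i
    · have := h2 i
      rw [shift_iterate] at this
      simpa using this

theorem cylinder_append {m n : ℕ} (ω : Fin m → I) (ν : Fin n → I) :
    cylinder (Fin.append ω ν) = cylinder ω ∩ shift^[m] ⁻¹' cylinder ν :=
  Set.ext fun _ => mem_cylinder_append

theorem prefixWord_add (m n : ℕ) (x : ℕ → I) :
    prefixWord (m + n) x = Fin.append (prefixWord m x) (prefixWord n (shift^[m] x)) :=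
  mem_cylinder_iff.1 (mem_cylinder_append.2
    ⟨mem_cylinder_prefixWord _ _, mem_cylinder_prefixWord _ _⟩)

/-! ### Hölder functions -/

theorem codeDist_le_exp {n : ℕ} {x y : ℕ → I} (h : ∀ k < n, x k = y k) :
    codeDist x y ≤ Real.exp (-(n : ℝ)) := by
  unfold codeDist
  split_ifs with hxy
  · positivity
  · refine Real.exp_le_exp.2 (neg_le_neg ?_)
    exact_mod_cast (PiNat.mem_cylinder_iff_le_firstDiff hxy n).1 h

/-- The form in which Hölder continuity is used: agreement on n symbols forces closeness at a
geometric rate. -/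
theorem IsHolder.exists_exp_bound {f : (ℕ → I) → ℝ} (hf : IsHolder f) :
    ∃ a : ℝ, 0 < a ∧ ∃ C : ℝ, 0 ≤ C ∧ ∀ (n : ℕ) (x y : ℕ → I), (∀ k < n, x k = y k) →
      |f x - f y| ≤ C * Real.exp (-a) ^ n := by
  obtain ⟨a, ha, C, hC⟩ := hf
  refine ⟨a, ha, |C|, abs_nonneg C, fun n x y h => (hC x y).trans ?_⟩
  have h1 : codeDist x y ^ a ≤ Real.exp (-a) ^ n := by
    refine (Real.rpow_le_rpow (codeDist_nonneg _ _) (codeDist_le_exp h) ha.le).trans_eq ?_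
    rw [← Real.exp_mul, ← Real.exp_nat_mul]
    ring_nf
  exact mul_le_mul (le_abs_self C) h1 (Real.rpow_nonneg (codeDist_nonneg _ _) _) (abs_nonneg C)

/-- After k shifts two points of an n-cylinder still agree on n − k symbols, so the differences are
dominated by a geometric series. -/
theorem IsHolder.exists_distortion {f : (ℕ → I) → ℝ} (hf : IsHolder f) :
    ∃ D : ℝ, IsDistortionConst f D := by
  obtain ⟨a, ha, C, hC0, hC⟩ := hf.exists_exp_bound
  have hr0 : 0 ≤ Real.exp (-a) := (Real.exp_pos _).le
  have hr1 : Real.exp (-a) < 1 := by simpa using ha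
  refine ⟨C * (1 - Real.exp (-a))⁻¹, fun n ω x hx y hy => ?_⟩
  unfold birkhoffSum
  rw [← Finset.sum_sub_distrib]
  refine (Finset.abs_sum_le_sum_abs _ _).trans ?_
  have h1 : ∀ k ∈ Finset.range n,
      |f (shift^[k] x) - f (shift^[k] y)| ≤ C * Real.exp (-a) ^ (n - 1 - k) := by
    intro k hk
    have hk' := Finset.mem_range.1 hk
    refine (hC (n - k) _ _ fun j hj => ?_).trans ?_
    · rw [shift_iterate, shift_iterate]
      have hkj : k + j < n := by omega
      exact (hx ⟨k + j, hkj⟩).trans (hy ⟨k + j, hkj⟩).symm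
    · exact mul_le_mul_of_nonneg_left
        (pow_le_pow_of_le_one hr0 hr1.le (by omega)) hC0
  refine (Finset.sum_le_sum h1).trans ?_
  rw [← Finset.mul_sum, Finset.sum_range_reflect (fun k => Real.exp (-a) ^ k)]
  refine mul_le_mul_of_nonneg_left ?_ hC0
  rw [← tsum_geometric_of_lt_one hr0 hr1]
  exact (summable_geometric_of_lt_one hr0 hr1).sum_le_tsum _ (fun _ _ => pow_nonneg hr0 _)

theorem IsHolder.smul_add {f ψ : (ℕ → I) → ℝ} (hf : IsHolder f) (hψ : IsHolder ψ) (s : ℝ) :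
    IsHolder (s • ψ + f) := by
  obtain ⟨a, ha, C, hC⟩ := hf
  obtain ⟨b, hb, B, hB⟩ := hψ
  refine ⟨min a b, lt_min ha hb, |s| * |B| + |C|, fun x y => ?_⟩
  -- Lowering the exponent increases a power only for a base in (0, 1], so distance zero is treated
  -- separately; there both functions take equal values.
  rcases (codeDist_nonneg x y).eq_or_lt with h0 | h0
  · have hx := hC x y
    have hy := hB x y
    rw [← h0, Real.zero_rpow ha.ne', mul_zero] at hx
    rw [← h0, Real.zero_rpow hb.ne', mul_zero] at hy
    rw [← h0, Real.zero_rpow (lt_min ha hb).ne', mul_zero]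
    have hx' := sub_eq_zero.1 (abs_eq_zero.1 (le_antisymm hx (abs_nonneg _)))
    have hy' := sub_eq_zero.1 (abs_eq_zero.1 (le_antisymm hy (abs_nonneg _)))
    simp [hx', hy']
  · have h1 := Real.rpow_le_rpow_of_exponent_ge h0 (codeDist_le_one x y) (min_le_left a b)
    have h2 := Real.rpow_le_rpow_of_exponent_ge h0 (codeDist_le_one x y) (min_le_right a b)
    have h3 : |f x - f y| ≤ |C| * codeDist x y ^ min a b := (hC x y).trans
      (mul_le_mul (le_abs_self C) h1 (by positivity) (abs_nonneg C))
    have h4 : |ψ x - ψ y| ≤ |B| * codeDist x y ^ min a b := (hB x y).trans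
      (mul_le_mul (le_abs_self B) h2 (by positivity) (abs_nonneg B))
    calc |(s • ψ + f) x - (s • ψ + f) y| = |s * (ψ x - ψ y) + (f x - f y)| := by
          simp only [Pi.add_apply, Pi.smul_apply, smul_eq_mul]; ring_nf
      _ ≤ |s| * |ψ x - ψ y| + |f x - f y| := (abs_add_le _ _).trans_eq (by rw [abs_mul])
      _ ≤ |s| * (|B| * codeDist x y ^ min a b) + |C| * codeDist x y ^ min a b := by gcongr
      _ = _ := by ring

theorem IsHolder.continuous [TopologicalSpace I] [DiscreteTopology I] {f : (ℕ → I) → ℝ}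
    (hf : IsHolder f) : Continuous f := by
  obtain ⟨a, ha, C, hC0, hC⟩ := hf.exists_exp_bound
  have hr0 : 0 ≤ Real.exp (-a) := (Real.exp_pos _).le
  have hr1 : Real.exp (-a) < 1 := by simpa using ha
  rw [continuous_iff_continuousAt]
  intro x
  rw [ContinuousAt, Metric.tendsto_nhds]
  intro ε hε
  have hlim : Tendsto (fun n : ℕ => C * Real.exp (-a) ^ n) atTop (𝓝 0) := by
    simpa using (tendsto_pow_atTop_nhds_zero_of_lt_one hr0 hr1).const_mul C
  obtain ⟨n, hn⟩ := (hlim.eventually (gt_mem_nhds hε)).exists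
  have hev : ∀ᶠ y in 𝓝 x, ∀ k < n, y k = x k := by
    exact (eventually_all_finite (Set.finite_lt_nat n)).2 fun k _ =>
      (continuous_apply k).continuousAt ((isOpen_discrete {x k}).mem_nhds rfl)
  filter_upwards [hev] with y hy
  exact (hC n y x hy).trans_lt hn

/-! ### Birkhoff sums and their suprema over cylinders -/

theorem IsDistortionConst.nonneg [Nonempty I] {f : (ℕ → I) → ℝ} {D : ℝ}
    (hD : IsDistortionConst f D) : 0 ≤ D := by
  obtain ⟨i⟩ := ‹Nonempty I›
  simpa using hD 0 Fin.elim0 (fun _ => i) (fun k => k.elim0) (fun _ => i) (fun k => k.elim0)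

theorem birkhoffSum_smul_add (f ψ : (ℕ → I) → ℝ) (s : ℝ) (n : ℕ) (x : ℕ → I) :
    birkhoffSum shift (s • ψ + f) n x =
      s * birkhoffSum shift ψ n x + birkhoffSum shift f n x := by
  simp [birkhoffSum, Finset.sum_add_distrib, Finset.mul_sum]

theorem IsDistortionConst.smul_add {f ψ : (ℕ → I) → ℝ} {D E : ℝ} (hD : IsDistortionConst f D)
    (hE : IsDistortionConst ψ E) (s : ℝ) : IsDistortionConst (s • ψ + f) (|s| * E + D) := by
  intro n ω x hx y hy
  rw [birkhoffSum_smul_add, birkhoffSum_smul_add]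
  calc _ = |s * (birkhoffSum shift ψ n x - birkhoffSum shift ψ n y) +
        (birkhoffSum shift f n x - birkhoffSum shift f n y)| := by ring_nf
    _ ≤ |s| * |birkhoffSum shift ψ n x - birkhoffSum shift ψ n y| +
        |birkhoffSum shift f n x - birkhoffSum shift f n y| :=
      (abs_add_le _ _).trans_eq (by rw [abs_mul])
    _ ≤ _ := by gcongr; exacts [hE n ω x hx y hy, hD n ω x hx y hy]

theorem supSum_le_of_forall [Nonempty I] {f : (ℕ → I) → ℝ} {n : ℕ} {ω : Fin n → I} {r : ℝ}
    (h : ∀ x ∈ cylinder ω, birkhoffSum shift f n x ≤ r) : supSum f ω ≤ r := by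
  have : Nonempty (cylinder ω) := (cylinder_nonempty ω).to_subtype
  exact ciSup_le fun x => h x x.2

theorem birkhoffSum_le_supSum [Nonempty I] {f : (ℕ → I) → ℝ} {D : ℝ}
    (hD : IsDistortionConst f D) {n : ℕ} {ω : Fin n → I} {x : ℕ → I} (hx : x ∈ cylinder ω) :
    birkhoffSum shift f n x ≤ supSum f ω := by
  refine le_ciSup (f := fun x : cylinder ω => birkhoffSum shift f n (x : ℕ → I))
    ⟨birkhoffSum shift f n x + D, ?_⟩ ⟨x, hx⟩
  rintro _ ⟨y, rfl⟩
  have := (abs_le.1 (hD n ω y y.2 x hx)).2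
  simp only
  linarith

theorem supSum_le_birkhoffSum_add [Nonempty I] {f : (ℕ → I) → ℝ} {D : ℝ}
    (hD : IsDistortionConst f D) {n : ℕ} {ω : Fin n → I} {x : ℕ → I} (hx : x ∈ cylinder ω) :
    supSum f ω ≤ birkhoffSum shift f n x + D :=
  supSum_le_of_forall fun y hy => by linarith [(abs_le.1 (hD n ω y hy x hx)).2]

theorem supSum_append_le' [Nonempty I] {f : (ℕ → I) → ℝ} {D : ℝ}
    (hD : IsDistortionConst f D) {m n : ℕ} (ω : Fin m → I) (ν : Fin n → I) :
    supSum f (Fin.append ω ν) ≤ supSum f ω + supSum f ν := by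
  refine supSum_le_of_forall fun x hx => ?_
  rw [birkhoffSum_add]
  have h := mem_cylinder_append.1 hx
  exact add_le_add (birkhoffSum_le_supSum hD h.1) (birkhoffSum_le_supSum hD h.2)

/-- Together with `supSum_append_le'` this makes S_ω additive under concatenation up to one
distortion constant. A point over ν is pulled back to one over ων by prefixing ω. -/
theorem le_supSum_append [Nonempty I] {f : (ℕ → I) → ℝ} {D : ℝ}
    (hD : IsDistortionConst f D) {m n : ℕ} (ω : Fin m → I) (ν : Fin n → I) :
    supSum f ω + supSum f ν - D ≤ supSum f (Fin.append ω ν) := by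
  have : supSum f ν ≤ supSum f (Fin.append ω ν) - supSum f ω + D := by
    refine supSum_le_of_forall fun y hy => ?_
    have h1 : wordCons ω y ∈ cylinder (Fin.append ω ν) :=
      mem_cylinder_append.2 ⟨wordCons_mem_cylinder ω y, by simpa using hy⟩
    have h2 := birkhoffSum_le_supSum hD h1
    rw [birkhoffSum_add, shift_iterate_wordCons] at h2
    have h3 := supSum_le_birkhoffSum_add hD (wordCons_mem_cylinder ω y)
    linarith
  linarith

theorem abs_supSum_smul_add_sub_le [Nonempty I] {f ψ : (ℕ → I) → ℝ} {D E : ℝ}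
    (hD : IsDistortionConst f D) (hE : IsDistortionConst ψ E) (s : ℝ) {n : ℕ} (ω : Fin n → I) :
    |supSum (s • ψ + f) ω - (s * supSum ψ ω + supSum f ω)| ≤ 2 * (|s| * E) + D := by
  obtain ⟨x, hx⟩ := cylinder_nonempty ω
  have h1 := birkhoffSum_le_supSum (hD.smul_add hE s) hx
  have h2 := supSum_le_birkhoffSum_add (hD.smul_add hE s) hx
  have h3 := birkhoffSum_le_supSum hD hx
  have h4 := supSum_le_birkhoffSum_add hD hx
  have h5 := birkhoffSum_le_supSum hE hx
  have h6 := supSum_le_birkhoffSum_add hE hx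
  rw [birkhoffSum_smul_add] at h1 h2
  have h7 : |s * (supSum ψ ω - birkhoffSum shift ψ n x)| ≤ |s| * E := by
    rw [abs_mul]
    exact mul_le_mul_of_nonneg_left (abs_le.2 ⟨by linarith [hE.nonneg], by linarith⟩)
      (abs_nonneg s)
  have h8 := abs_le.1 h7
  rw [mul_sub] at h8
  rw [abs_le]
  constructor <;> linarith [h8.1, h8.2]

/-! ### Partition sums and pressure -/

theorem partitionSum_univ [Fintype I] (f : (ℕ → I) → ℝ) (n : ℕ) :
    partitionSum f Set.univ n = ∑ ω : Fin n → I, Real.exp (supSum f ω) := by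
  simp [partitionSum]

theorem partitionSum_zero [Fintype I] [Nonempty I] (f : (ℕ → I) → ℝ) (J : Set I) :
    partitionSum f J 0 = 1 := by
  have : ∀ ω : Fin 0 → I, supSum f ω = 0 := fun ω => by
    have : Nonempty (cylinder ω) := (cylinder_nonempty ω).to_subtype
    simp [supSum]
  simp [partitionSum, this]

theorem pressureOn_eq_lim [Fintype I] [Nonempty I] {f : (ℕ → I) → ℝ} (hf : IsHolder f)
    {J : Set I} (hJ : J.Nonempty)
    (hsub : Subadditive fun n : ℕ => Real.log (partitionSum f J n)) : 
    pressureOn f J = hsub.lim ∧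
      BddBelow (Set.range fun n : ℕ => Real.log (partitionSum f J n) / n) := by
  have hb := (tendsto_pressureOn hf hJ).bddBelow_range
  exact ⟨tendsto_nhds_unique (tendsto_pressureOn hf hJ) (hsub.tendsto_lim hb), hb⟩

theorem mul_pressureOn_le_log [Fintype I] [Nonempty I] {f : (ℕ → I) → ℝ} (hf : IsHolder f)
    {J : Set I} (hJ : J.Nonempty) (n : ℕ) :
    n * pressureOn f J ≤ Real.log (partitionSum f J n) := by
  obtain ⟨M, -, hM⟩ := hf.bounded
  have hsub : Subadditive (fun n : ℕ => Real.log (partitionSum f J n)) := fun m n => by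
    rw [← Real.log_mul (partitionSum_pos f hJ m).ne' (partitionSum_pos f hJ n).ne']
    exact Real.log_le_log (partitionSum_pos f hJ _) (partitionSum_add_le hM J m n)
  obtain ⟨h1, hb⟩ := pressureOn_eq_lim hf hJ hsub
  rcases Nat.eq_zero_or_pos n with rfl | hn
  · simp [partitionSum_zero]
  · have h2 := hsub.lim_le_div hb hn.ne'
    rw [← h1, le_div_iff₀ (by exact_mod_cast hn)] at h2
    linarith

theorem exp_mul_pressureOn_le [Fintype I] [Nonempty I] {f : (ℕ → I) → ℝ} (hf : IsHolder f)
    {J : Set I} (hJ : J.Nonempty) (n : ℕ) :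
    Real.exp (n * pressureOn f J) ≤ partitionSum f J n :=
  (Real.le_log_iff_exp_le (partitionSum_pos f hJ n)).1 (mul_pressureOn_le_log hf hJ n)

theorem sum_append [Fintype I] {β : Type*} [AddCommMonoid β] {m n : ℕ}
    (F : (Fin (m + n) → I) → β) :
    ∑ ω, F ω = ∑ ω : Fin m → I, ∑ ν : Fin n → I, F (Fin.append ω ν) := by
  rw [← Fintype.sum_prod_type']
  exact (Fintype.sum_equiv (Fin.appendEquiv m n) _ _ fun _ => rfl).symm

theorem partitionSum_mul_le [Fintype I] [Nonempty I] {f : (ℕ → I) → ℝ} {D : ℝ}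
    (hD : IsDistortionConst f D) (m n : ℕ) :
    partitionSum f Set.univ m * partitionSum f Set.univ n ≤
      Real.exp D * partitionSum f Set.univ (m + n) := by
  rw [partitionSum_univ, partitionSum_univ, partitionSum_univ, sum_append, Finset.sum_mul_sum,
    Finset.mul_sum]
  refine Finset.sum_le_sum fun ω _ => ?_
  rw [Finset.mul_sum]
  refine Finset.sum_le_sum fun ν _ => ?_
  rw [← Real.exp_add, ← Real.exp_add, Real.exp_le_exp]
  linarith [le_supSum_append hD ω ν]

theorem tendsto_pressure [Fintype I] [Nonempty I] {f : (ℕ → I) → ℝ} (hf : IsHolder f) :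
    Tendsto (fun n : ℕ => Real.log (partitionSum f Set.univ n) / n) atTop (𝓝 (pressure f)) :=
  tendsto_pressureOn hf Set.univ_nonempty

/-- Both log Z_n and D − log Z_n are subadditive, so Fekete's lemma pins log Z_n between nP and nP +
D. Consequently the weights of the n-words sum to a number in [1, e^D]. -/
theorem partitionSum_le_exp [Fintype I] [Nonempty I] {f : (ℕ → I) → ℝ} (hf : IsHolder f) {D : ℝ}
    (hD : IsDistortionConst f D) (n : ℕ) :
    partitionSum f Set.univ n ≤ Real.exp (D + n * pressure f) := by
  have hpos := partitionSum_pos f (Set.univ_nonempty (α := I))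
  have hsub : Subadditive (fun n : ℕ => D - Real.log (partitionSum f Set.univ n)) := fun m n => by
    have := Real.log_le_log (mul_pos (hpos m) (hpos n)) (partitionSum_mul_le hD m n)
    rw [Real.log_mul (hpos m).ne' (hpos n).ne', Real.log_mul (by positivity) (hpos _).ne',
      Real.log_exp] at this
    linarith
  have hlim : Tendsto (fun n : ℕ => (D - Real.log (partitionSum f Set.univ n)) / n) atTop
      (𝓝 (-pressure f)) := by
    have := (tendsto_const_div_atTop_nhds_zero_nat D).sub (tendsto_pressure hf)
    simpa [sub_div] using this
  have hb := hlim.bddBelow_range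
  have h1 : -pressure f = hsub.lim := tendsto_nhds_unique hlim (hsub.tendsto_lim hb)
  rw [← Real.log_le_iff_le_exp (hpos n)]
  rcases Nat.eq_zero_or_pos n with rfl | hn
  · simpa [partitionSum_zero] using hD.nonneg
  · have h2 := hsub.lim_le_div hb hn.ne'
    rw [← h1, le_div_iff₀ (by exact_mod_cast hn)] at h2
    linarith

theorem pressure_le_of_partitionSum_le [Fintype I] [Nonempty I] {f g : (ℕ → I) → ℝ}
    (hf : IsHolder f) (hg : IsHolder g) {A r : ℝ}
    (h : ∀ n : ℕ, partitionSum f Set.univ n ≤ Real.exp (A + n * r) * partitionSum g Set.univ n) :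
    pressure f ≤ pressure g + r := by
  have hpos := fun f : (ℕ → I) → ℝ => partitionSum_pos f (Set.univ_nonempty (α := I))
  have hlim := ((tendsto_const_div_atTop_nhds_zero_nat A).add
    (tendsto_pressure hg)).add_const r
  rw [zero_add] at hlim
  refine le_of_tendsto_of_tendsto (tendsto_pressure hf) hlim ?_
  filter_upwards [eventually_gt_atTop 0] with n hn
  have hn' : (0 : ℝ) < n := by exact_mod_cast hn
  have h1 := Real.log_le_log (hpos f n) (h n)
  rw [Real.log_mul (by positivity) (hpos g n).ne', Real.log_exp] at h1
  rw [div_le_iff₀ hn']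
  calc _ ≤ _ := h1
    _ = _ := by field_simp; ring

theorem partitionSum_le_of_forall_le [Fintype I] [Nonempty I] {f g : (ℕ → I) → ℝ}
    (hg : IsHolder g) {r : ℝ} (h : ∀ x, f x ≤ g x + r) (n : ℕ) :
    partitionSum f Set.univ n ≤ Real.exp (n * r) * partitionSum g Set.univ n := by
  obtain ⟨D, hD⟩ := hg.exists_distortion
  rw [partitionSum_univ, partitionSum_univ, Finset.mul_sum]
  refine Finset.sum_le_sum fun ω _ => ?_
  rw [← Real.exp_add, Real.exp_le_exp]
  refine supSum_le_of_forall fun x hx => ?_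
  have h1 : birkhoffSum shift f n x ≤ birkhoffSum shift g n x + n * r := by
    unfold birkhoffSum
    refine (Finset.sum_le_sum fun k _ => h _).trans_eq ?_
    simp [Finset.sum_add_distrib]
  linarith [birkhoffSum_le_supSum hD hx]

theorem pressure_le_add_of_forall_le [Fintype I] [Nonempty I] {f g : (ℕ → I) → ℝ}
    (hf : IsHolder f) (hg : IsHolder g) {r : ℝ} (h : ∀ x, f x ≤ g x + r) :
    pressure f ≤ pressure g + r :=
  pressure_le_of_partitionSum_le (A := 0) hf hg fun n => by
    simpa using partitionSum_le_of_forall_le hg h n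

theorem birkhoffSum_le_log_partitionSum [Fintype I] [Nonempty I] {f : (ℕ → I) → ℝ}
    (hf : IsHolder f) (n : ℕ) (x : ℕ → I) :
    birkhoffSum shift f n x ≤ Real.log (partitionSum f Set.univ n) := by
  obtain ⟨D, hD⟩ := hf.exists_distortion
  rw [Real.le_log_iff_exp_le (partitionSum_pos f Set.univ_nonempty n), partitionSum_univ]
  refine (Real.exp_le_exp.2 (birkhoffSum_le_supSum hD (mem_cylinder_prefixWord n x))).trans ?_
  exact Finset.single_le_sum (f := fun ω : Fin n → I => Real.exp (supSum f ω))
    (fun _ _ => (Real.exp_pos _).le) (Finset.mem_univ _)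

theorem le_pressure_of_frequently [Fintype I] [Nonempty I] {f : (ℕ → I) → ℝ}
    (hf : IsHolder f) {r : ℝ} {x : ℕ → I}
    (h : ∃ᶠ n : ℕ in atTop, r ≤ birkhoffSum shift f n x / n) : r ≤ pressure f := by
  refine ge_of_tendsto_of_frequently (tendsto_pressure hf) (h.mono fun n hn => hn.trans ?_)
  exact div_le_div_of_nonneg_right (birkhoffSum_le_log_partitionSum hf n x) n.cast_nonneg

/-! ### Normalised weights of words -/

/-- The weight `exp (S_ω g - |ω| P(g))` of a word. -/
def weight [Fintype I] (g : (ℕ → I) → ℝ) {n : ℕ} (ω : Fin n → I) : ℝ :=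
  Real.exp (supSum g ω - n * pressure g)

section Weight

variable [Fintype I] {g : (ℕ → I) → ℝ} {D : ℝ}

theorem weight_pos {n : ℕ} (ω : Fin n → I) : 0 < weight g ω := Real.exp_pos _

theorem sum_weight_eq (n : ℕ) :
    ∑ ω : Fin n → I, weight g ω =
      partitionSum g Set.univ n * Real.exp (-(n * pressure g)) := by
  rw [partitionSum_univ, Finset.sum_mul]
  exact Finset.sum_congr rfl fun ω _ => by rw [← Real.exp_add]; rfl

variable [Nonempty I]

theorem weight_append_le (hD : IsDistortionConst g D) {m n : ℕ} (ω : Fin m → I)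
    (ν : Fin n → I) : weight g (Fin.append ω ν) ≤ weight g ω * weight g ν := by
  unfold weight
  rw [← Real.exp_add, Real.exp_le_exp]
  push_cast
  linarith [supSum_append_le' hD ω ν]

theorem weight_mul_le (hD : IsDistortionConst g D) {m n : ℕ} (ω : Fin m → I)
    (ν : Fin n → I) : weight g ω * weight g ν ≤ Real.exp D * weight g (Fin.append ω ν) := by
  unfold weight
  rw [← Real.exp_add, ← Real.exp_add, Real.exp_le_exp]
  push_cast
  linarith [le_supSum_append hD ω ν]

theorem one_le_sum_weight (hg : IsHolder g) (n : ℕ) : 1 ≤ ∑ ω : Fin n → I, weight g ω := by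
  rw [sum_weight_eq, Real.exp_neg, ← div_eq_mul_inv, one_le_div (Real.exp_pos _)]
  exact exp_mul_pressureOn_le hg Set.univ_nonempty n

theorem sum_weight_le (hg : IsHolder g) (hD : IsDistortionConst g D) (n : ℕ) :
    ∑ ω : Fin n → I, weight g ω ≤ Real.exp D := by
  rw [sum_weight_eq, Real.exp_neg, ← div_eq_mul_inv, div_le_iff₀ (Real.exp_pos _),
    ← Real.exp_add]
  exact partitionSum_le_exp hg hD n

end Weight

/-! ### Measures on the shift space and cylinders -/

theorem measurable_shift [MeasurableSpace I] : Measurable (shift : (ℕ → I) → ℕ → I) :=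
  measurable_pi_lambda _ fun n => measurable_pi_apply (n + 1)

theorem measurable_prefixWord [MeasurableSpace I] (n : ℕ) :
    Measurable (prefixWord n : (ℕ → I) → Fin n → I) :=
  measurable_pi_lambda _ fun k => measurable_pi_apply (k : ℕ)

theorem cylinder_eq_preimage {n : ℕ} (ω : Fin n → I) : cylinder ω = prefixWord n ⁻¹' {ω} :=
  Set.ext fun _ => mem_cylinder_iff

theorem exists_cylinder_subset [TopologicalSpace I] {U : Set (ℕ → I)} (hU : IsOpen U)
    {x : ℕ → I} (hx : x ∈ U) : ∃ n, cylinder (prefixWord n x) ⊆ U := by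
  obtain ⟨F, u, hu, hF⟩ := isOpen_pi_iff.1 hU x hx
  refine ⟨F.sup id + 1, fun y hy => hF fun k hk => ?_⟩
  have hk' : k < F.sup id + 1 := Nat.lt_succ_of_le (Finset.le_sup (f := id) hk)
  have : y k = x k := hy ⟨k, hk'⟩
  rw [this]
  exact (hu k hk).2

section Measurability

variable [Fintype I] [MeasurableSpace I] [DiscreteMeasurableSpace I]

theorem measurableSet_prefixWord_preimage (n : ℕ) (S : Set (Fin n → I)) :
    MeasurableSet (prefixWord n ⁻¹' S) :=
  measurable_prefixWord n S.toFinite.measurableSet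

theorem measurableSet_cylinder {n : ℕ} (ω : Fin n → I) : MeasurableSet (cylinder ω) := by
  rw [cylinder_eq_preimage]
  exact measurableSet_prefixWord_preimage n _

open Classical in
theorem measureReal_prefixWord_preimage (μ : Measure (ℕ → I)) [IsFiniteMeasure μ] (n : ℕ)
    (S : Set (Fin n → I)) :
    μ.real (prefixWord n ⁻¹' S) = ∑ ω with ω ∈ S, μ.real (cylinder ω) := by
  have h : prefixWord n ⁻¹' S = ⋃ ω ∈ Finset.univ.filter (· ∈ S), cylinder ω := by
    ext x
    simp [mem_cylinder_iff]
  rw [h, measureReal_biUnion_finset]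
  · intro ω _ ν _ hne
    refine Set.disjoint_left.2 fun x hx hy => hne ?_
    exact (mem_cylinder_iff.1 hx).symm.trans (mem_cylinder_iff.1 hy)
  · exact fun ω _ => measurableSet_cylinder ω

/-- Domination on cylinders implies domination on all sets. -/
theorem measure_le_smul_of_cylinder {μ ν : Measure (ℕ → I)} [IsFiniteMeasure μ]
    [IsFiniteMeasure ν] {C : NNReal}
    (h : ∀ (n : ℕ) (ω : Fin n → I), μ.real (cylinder ω) ≤ C * ν.real (cylinder ω)) :
    μ ≤ C • ν := by
  classical
  let _ : TopologicalSpace I := ⊥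
  have _ : DiscreteTopology I := ⟨rfl⟩
  have hpre : ∀ n (S : Set (Fin n → I)),
      μ (prefixWord n ⁻¹' S) ≤ (C • ν) (prefixWord n ⁻¹' S) := by
    intro n S
    rw [← ENNReal.toReal_le_toReal (measure_ne_top _ _) (measure_ne_top _ _)]
    change μ.real _ ≤ (C • ν).real _
    rw [measureReal_nnreal_smul_apply, measureReal_prefixWord_preimage,
      measureReal_prefixWord_preimage, Finset.mul_sum]
    exact Finset.sum_le_sum fun ω _ => h n ω
  -- An open set is the increasing union over n of the n-cylinders it contains; outer regularity
  -- then passes to arbitrary sets.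
  have hopen : ∀ U : Set (ℕ → I), IsOpen U → μ U ≤ (C • ν) U := by
    intro U hU
    have hmono : Monotone fun n => prefixWord n ⁻¹' {ω : Fin n → I | cylinder ω ⊆ U} := by
      intro m n hmn x hx
      have hsub : cylinder (prefixWord n x) ⊆ cylinder (prefixWord m x) :=
        fun y hy k => hy ⟨k, k.2.trans_le hmn⟩
      exact hsub.trans hx
    have hUn : U = ⋃ n, prefixWord n ⁻¹' {ω : Fin n → I | cylinder ω ⊆ U} := by
      ext x
      simp only [Set.mem_iUnion, Set.mem_preimage, Set.mem_ofPred_eq]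
      exact ⟨fun hx => exists_cylinder_subset hU hx,
        fun ⟨n, hn⟩ => hn (mem_cylinder_prefixWord n x)⟩
    rw [hUn, hmono.measure_iUnion, hmono.measure_iUnion]
    exact iSup_mono fun n => hpre n _
  refine Measure.le_iff.2 fun A _ => ?_
  rw [A.measure_eq_iInf_isOpen (C • ν)]
  exact le_iInf fun U => le_iInf fun hAU => le_iInf fun hU =>
    (measure_mono hAU).trans (hopen U hU)

theorem measureReal_le_of_cylinder {μ ν : Measure (ℕ → I)} [IsFiniteMeasure μ]
    [IsFiniteMeasure ν] {C : ℝ} (hC : 0 ≤ C)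
    (h : ∀ (n : ℕ) (ω : Fin n → I), μ.real (cylinder ω) ≤ C * ν.real (cylinder ω))
    (A : Set (ℕ → I)) : μ.real A ≤ C * ν.real A := by
  lift C to NNReal using hC
  have := measure_le_smul_of_cylinder h A
  rw [← ENNReal.toReal_le_toReal (measure_ne_top _ _) (measure_ne_top _ _)] at this
  change μ.real _ ≤ (C • ν).real _ at this
  rwa [measureReal_nnreal_smul_apply] at this

theorem absolutelyContinuous_of_cylinder {μ ν : Measure (ℕ → I)} [IsFiniteMeasure μ]
    [IsFiniteMeasure ν] {C : ℝ} (hC : 0 ≤ C)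
    (h : ∀ (n : ℕ) (ω : Fin n → I), μ.real (cylinder ω) ≤ C * ν.real (cylinder ω)) :
    μ ≪ ν := by
  refine Measure.AbsolutelyContinuous.mk fun A _ hA => ?_
  have h1 := measureReal_le_of_cylinder hC h A
  have h2 : ν.real A = 0 := by simp [Measure.real, hA]
  rw [h2, mul_zero] at h1
  exact (measureReal_eq_zero_iff).1 (le_antisymm h1 measureReal_nonneg)

theorem measure_ext_of_cylinder {μ ν : Measure (ℕ → I)} [IsFiniteMeasure μ]
    [IsFiniteMeasure ν]
    (h : ∀ (n : ℕ) (ω : Fin n → I), μ.real (cylinder ω) = ν.real (cylinder ω)) : μ = ν := by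
  refine le_antisymm ?_ ?_
  · simpa using measure_le_smul_of_cylinder (C := 1) fun n ω => by simp [h n ω]
  · simpa using measure_le_smul_of_cylinder (C := 1) fun n ω => by simp [h n ω]

end Measurability

/-! ### Measures with Gibbs bounds -/

/-- The measure of each cylinder is comparable to the weight of its word. -/
def WeightBounds [Fintype I] [MeasurableSpace I] (g : (ℕ → I) → ℝ) (c : ℝ)
    (μ : Measure (ℕ → I)) : Prop :=
  ∀ (n : ℕ) (ω : Fin n → I),
    weight g ω ≤ c * μ.real (cylinder ω) ∧ μ.real (cylinder ω) ≤ c * weight g ω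

theorem WeightBounds.measureReal_cylinder_pos [Fintype I] [MeasurableSpace I]
    {g : (ℕ → I) → ℝ} {c : ℝ} {μ : Measure (ℕ → I)} (hc : 0 < c) (h : WeightBounds g c μ) {n : ℕ}
    (ω : Fin n → I) : 0 < μ.real (cylinder ω) :=
  (pos_iff_pos_of_mul_pos ((weight_pos ω).trans_le (h n ω).1)).1 hc

theorem measureReal_map_restrict_cylinder [Fintype I] [MeasurableSpace I]
    [DiscreteMeasurableSpace I] {μ : Measure (ℕ → I)} {n : ℕ} (ω : Fin n → I) {B : Set (ℕ → I)}
    (hB : MeasurableSet B) : ((μ.restrict (cylinder ω)).map shift^[n]).real B =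
      μ.real (cylinder ω ∩ shift^[n] ⁻¹' B) := by
  rw [map_measureReal_apply (measurable_shift.iterate n) hB,
    measureReal_restrict_apply (measurable_shift.iterate n hB), Set.inter_comm]

section Gibbs

variable [Fintype I] [Nonempty I] [MeasurableSpace I] {g : (ℕ → I) → ℝ} {D c : ℝ}
  {μ : Measure (ℕ → I)}

theorem IsGibbsMeasure.exists_weightBounds (hD : IsDistortionConst g D)
    (hμ : IsGibbsMeasure g μ) : ∃ c, 0 < c ∧ WeightBounds g c μ := by
  obtain ⟨c, hc1, hc⟩ := hμ.gibbs
  have hc0 : 0 < c := by linarith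
  have hD1 : 1 ≤ Real.exp D := Real.one_le_exp hD.nonneg
  refine ⟨c * Real.exp D, by positivity, fun n ω => ?_⟩
  obtain ⟨x, hx⟩ := cylinder_nonempty ω
  have hw := weight_pos (g := g) ω
  obtain ⟨h1, h2⟩ := hc n ω x hx
  rw [le_div_iff₀ (Real.exp_pos _)] at h1
  rw [div_le_iff₀ (Real.exp_pos _)] at h2
  have h3 : Real.exp (birkhoffSum shift g n x - n * pressure g) ≤ weight g ω :=
    Real.exp_le_exp.2 (by linarith [birkhoffSum_le_supSum hD hx])
  have h4 : weight g ω ≤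
      Real.exp D * Real.exp (birkhoffSum shift g n x - n * pressure g) := by
    rw [← Real.exp_add]
    exact Real.exp_le_exp.2 (by linarith [supSum_le_birkhoffSum_add hD hx])
  constructor
  · rw [inv_mul_le_iff₀ hc0] at h1
    calc weight g ω ≤ _ := h4
      _ ≤ Real.exp D * (c * μ.real (cylinder ω)) := by gcongr
      _ = _ := by ring
  · calc μ.real (cylinder ω) ≤ _ := h2
      _ ≤ c * weight g ω := by gcongr
      _ ≤ c * Real.exp D * weight g ω := by
        rw [mul_assoc]
        exact mul_le_mul_of_nonneg_left (le_mul_of_one_le_left hw.le hD1) hc0.le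

theorem WeightBounds.isGibbsMeasure [IsProbabilityMeasure μ] (hD : IsDistortionConst g D)
    (hinv : MeasurePreserving shift μ μ) (hc : 0 < c) (h : WeightBounds g c μ) :
    IsGibbsMeasure g μ := by
  refine ⟨inferInstance, hinv, max 1 (c * Real.exp D), le_max_left _ _, fun n ω x hx => ?_⟩
  have hw := weight_pos (g := g) ω
  have hD1 : 1 ≤ Real.exp D := Real.one_le_exp hD.nonneg
  have h3 : Real.exp (birkhoffSum shift g n x - n * pressure g) ≤ weight g ω :=
    Real.exp_le_exp.2 (by linarith [birkhoffSum_le_supSum hD hx])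
  have h4 : weight g ω ≤
      Real.exp D * Real.exp (birkhoffSum shift g n x - n * pressure g) := by
    rw [← Real.exp_add]
    exact Real.exp_le_exp.2 (by linarith [supSum_le_birkhoffSum_add hD hx])
  obtain ⟨h1, h2⟩ := h n ω
  have hC : 0 < max 1 (c * Real.exp D) := by positivity
  constructor
  · rw [le_div_iff₀ (Real.exp_pos _), inv_mul_le_iff₀ hC]
    refine h3.trans (h1.trans (mul_le_mul_of_nonneg_right ?_ measureReal_nonneg))
    exact le_max_of_le_right (le_mul_of_one_le_right hc.le hD1)
  · rw [div_le_iff₀ (Real.exp_pos _)]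
    calc μ.real (cylinder ω) ≤ c * weight g ω := h2
      _ ≤ c * (Real.exp D * Real.exp (birkhoffSum shift g n x - n * pressure g)) := by gcongr
      _ = c * Real.exp D * Real.exp (birkhoffSum shift g n x - n * pressure g) := by ring
      _ ≤ _ := by gcongr; exact le_max_right _ _

variable [DiscreteMeasurableSpace I] [IsFiniteMeasure μ]

theorem WeightBounds.measureReal_cylinder_inter_le (hc : 0 < c) (h : WeightBounds g c μ)
    (hD : IsDistortionConst g D) {n : ℕ} (ω : Fin n → I) {B : Set (ℕ → I)}
    (hB : MeasurableSet B) :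
    μ.real (cylinder ω ∩ shift^[n] ⁻¹' B) ≤ c ^ 3 * μ.real (cylinder ω) * μ.real B := by
  rw [← measureReal_map_restrict_cylinder ω hB]
  refine measureReal_le_of_cylinder (by positivity) (fun m ν => ?_) B
  rw [measureReal_map_restrict_cylinder ω (measurableSet_cylinder ν), ← cylinder_append]
  have h1 := (weight_pos (g := g) ω).le
  have h2 := (weight_pos (g := g) ν).le
  calc μ.real (cylinder (Fin.append ω ν)) ≤ c * weight g (Fin.append ω ν) := (h _ _).2
    _ ≤ c * (weight g ω * weight g ν) := by gcongr; exact weight_append_le hD ω ν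
    _ ≤ c * ((c * μ.real (cylinder ω)) * (c * μ.real (cylinder ν))) := by
      gcongr
      · exact (h _ _).1
      · exact (h _ _).1
    _ = _ := by ring

/-- Quasi-independence of the first n symbols and the future. Both sides are measures in B, so
cylinders suffice, where the claim is near-multiplicativity of weights. Each of the three uses of
the Gibbs bounds costs a factor c. -/
theorem WeightBounds.le_measureReal_cylinder_inter (hc : 0 < c) (h : WeightBounds g c μ)
    (hD : IsDistortionConst g D) {n : ℕ} (ω : Fin n → I) {B : Set (ℕ → I)}
    (hB : MeasurableSet B) :
    μ.real (cylinder ω) * μ.real B ≤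
      c ^ 3 * Real.exp D * μ.real (cylinder ω ∩ shift^[n] ⁻¹' B) := by
  have hpos := h.measureReal_cylinder_pos hc ω
  suffices μ.real B ≤ c ^ 3 * Real.exp D / μ.real (cylinder ω) *
      ((μ.restrict (cylinder ω)).map shift^[n]).real B by
    rw [measureReal_map_restrict_cylinder ω hB, div_mul_eq_mul_div, le_div_iff₀ hpos] at this
    linarith
  refine measureReal_le_of_cylinder (by positivity) (fun m ν => ?_) B
  rw [measureReal_map_restrict_cylinder ω (measurableSet_cylinder ν), ← cylinder_append,
    div_mul_eq_mul_div, le_div_iff₀ hpos, mul_comm]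
  have h1 := (weight_pos (g := g) ω).le
  have h2 := (weight_pos (g := g) ν).le
  calc μ.real (cylinder ω) * μ.real (cylinder ν) ≤ (c * weight g ω) * (c * weight g ν) := by
        gcongr
        · exact (h _ _).2
        · exact (h _ _).2
    _ = c ^ 2 * (weight g ω * weight g ν) := by ring
    _ ≤ c ^ 2 * (Real.exp D * weight g (Fin.append ω ν)) :=
      mul_le_mul_of_nonneg_left (weight_mul_le hD ω ν) (by positivity)
    _ ≤ c ^ 2 * (Real.exp D * (c * μ.real (cylinder (Fin.append ω ν)))) := by
      gcongr; exact (h _ _).1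
    _ = _ := by ring

/-- For an invariant set A, quasi-independence reads μ[ω] μ(A) ≤ C μ([ω] ∩ A) on all cylinders,
hence with [ω] replaced by any set. Taking the complement of A gives μ(A) μ(Aᶜ) = 0. -/
theorem WeightBounds.ergodic (hc : 0 < c) (h : WeightBounds g c μ)
    (hD : IsDistortionConst g D) (hinv : MeasurePreserving shift μ μ) : Ergodic shift μ := by
  refine ⟨hinv, ⟨fun A hA hAinv => ?_⟩⟩
  have hit : ∀ n, shift^[n] ⁻¹' A = A := fun n => by
    induction n with
    | zero => rfl
    | succ n ih => rw [Function.iterate_succ, Set.preimage_comp, ih, hAinv]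
  have h0 : μ.real A * μ.real Aᶜ ≤ 0 := by
    rcases (measureReal_nonneg (μ := μ) (s := A)).eq_or_lt with hz | hpos
    · rw [← hz, zero_mul]
    have key : μ.real Aᶜ ≤ c ^ 3 * Real.exp D / μ.real A * (μ.restrict A).real Aᶜ := by
      refine measureReal_le_of_cylinder (by positivity) (fun n ω => ?_) Aᶜ
      have := h.le_measureReal_cylinder_inter hc hD ω hA
      rw [hit] at this
      rw [measureReal_restrict_apply (measurableSet_cylinder ω), div_mul_eq_mul_div,
        le_div_iff₀ hpos]
      exact this
    rw [measureReal_restrict_apply hA.compl, Set.compl_inter_self, measureReal_empty,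
      mul_zero] at key
    exact mul_nonpos_of_nonneg_of_nonpos hpos.le key
  have h1 := le_antisymm h0 (mul_nonneg measureReal_nonneg measureReal_nonneg)
  rw [eventuallyConst_set']
  rcases mul_eq_zero.1 h1 with h2 | h2
  · left
    exact ae_eq_empty.2 ((measureReal_eq_zero_iff).1 h2)
  · right
    exact ae_eq_univ.2 ((measureReal_eq_zero_iff).1 h2)

theorem IsGibbsMeasure.ergodic (hD : IsDistortionConst g D) (hμ : IsGibbsMeasure g μ) :
    Ergodic shift μ := by
  obtain ⟨c, hc, h⟩ := hμ.exists_weightBounds hD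
  exact h.ergodic hc hD hμ.invariant

/-- Two Gibbs measures are mutually absolutely continuous by the cylinder bounds, and an ergodic
measure is the only invariant probability measure absolutely continuous with respect to it. -/
theorem IsGibbsMeasure.eq (hD : IsDistortionConst g D) {ν : Measure (ℕ → I)}
    (hμ : IsGibbsMeasure g μ) (hν : IsGibbsMeasure g ν) : μ = ν := by
  have _ := hμ.isProbabilityMeasure
  have _ := hν.isProbabilityMeasure
  obtain ⟨c, hc, h⟩ := hμ.exists_weightBounds hD
  obtain ⟨c', hc', h'⟩ := hν.exists_weightBounds hD
  refine (hν.ergodic hD).eq_of_absolutelyContinuous hμ.invariant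
    (absolutelyContinuous_of_cylinder (C := c * c') (by positivity) fun n ω => ?_)
  calc _ ≤ _ := (h n ω).2
    _ ≤ c * (c' * ν.real (cylinder ω)) := by gcongr; exact (h' n ω).1
    _ = _ := by ring

end Gibbs

/-! ### Weak limits -/

theorem continuous_shift [TopologicalSpace I] : Continuous (shift : (ℕ → I) → ℕ → I) :=
  continuous_pi fun n => continuous_apply (n + 1)

theorem isClopen_cylinder [TopologicalSpace I] [DiscreteTopology I] {n : ℕ} (ω : Fin n → I) :
    IsClopen (cylinder ω) := by
  have h : Continuous (prefixWord n : (ℕ → I) → Fin n → I) :=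
    continuous_pi fun k => continuous_apply (k : ℕ)
  rw [cylinder_eq_preimage]
  exact (isClopen_discrete {ω}).preimage h

section WeakLimit

variable [Fintype I] [MeasurableSpace I] [DiscreteMeasurableSpace I] [TopologicalSpace I]
  [DiscreteTopology I]

/-- Probability measures on the compact shift space form a compact space; ultrafilters replace the
extraction of convergent subsequences. -/
theorem exists_tendsto_of_ultrafilter {ι : Type*} (U : Ultrafilter ι)
    (μ : ι → ProbabilityMeasure (ℕ → I)) :
    ∃ ν : ProbabilityMeasure (ℕ → I), Tendsto μ U (𝓝 ν) :=
  have : Nonempty (ProbabilityMeasure (ℕ → I)) := U.neBot.nonempty.map μ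
  ⟨_, (U.map μ).le_nhds_lim⟩

theorem tendsto_measureReal_of_isClopen {ι : Type*} {l : Filter ι}
    {μ : ι → ProbabilityMeasure (ℕ → I)} {ν : ProbabilityMeasure (ℕ → I)}
    (h : Tendsto μ l (𝓝 ν)) {A : Set (ℕ → I)} (hA : IsClopen A) :
    Tendsto (fun i => (μ i : Measure (ℕ → I)).real A) l (𝓝 ((ν : Measure (ℕ → I)).real A)) := by
  refine (ENNReal.tendsto_toReal (measure_ne_top _ _)).comp ?_
  exact ProbabilityMeasure.tendsto_measure_of_null_frontier_of_tendsto' h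
    (by simp [hA.frontier_eq])

end WeakLimit

/-! ### Existence of Gibbs measures -/

section Existence

variable [Fintype I] [Nonempty I] [MeasurableSpace I] [DiscreteMeasurableSpace I]
  {g : (ℕ → I) → ℝ} {D : ℝ}

theorem sum_measureReal_cylinder_inter (μ : Measure (ℕ → I)) [IsFiniteMeasure μ] (n : ℕ)
    (B : Set (ℕ → I)) :
    ∑ ω : Fin n → I, μ.real (cylinder ω ∩ B) = μ.real B := by
  have h := measureReal_prefixWord_preimage (μ.restrict B) n Set.univ
  simp only [Set.preimage_univ, measureReal_restrict_apply_univ, Set.mem_univ,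
    Finset.filter_true] at h
  rw [h]
  exact Finset.sum_congr rfl fun ω _ =>
    (measureReal_restrict_apply (measurableSet_cylinder ω)).symm

/-- The normalised weighted sum of point masses, one for each word of length `N`. -/
def wordMeasure (g : (ℕ → I) → ℝ) (x : ℕ → I) (N : ℕ) : Measure (ℕ → I) :=
  ∑ ω : Fin N → I, ENNReal.ofReal (weight g ω / ∑ τ : Fin N → I, weight g τ) •
    Measure.dirac (wordCons ω x)

theorem sum_weight_pos (g : (ℕ → I) → ℝ) (n : ℕ) : 0 < ∑ ω : Fin n → I, weight g ω :=
  Finset.sum_pos (fun ω _ => weight_pos ω) Finset.univ_nonempty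

theorem measureReal_wordMeasure (g : (ℕ → I) → ℝ) (x : ℕ → I) (N : ℕ) {A : Set (ℕ → I)}
    (hA : MeasurableSet A) : (wordMeasure g x N).real A =
      (∑ ω : Fin N → I, weight g ω * A.indicator 1 (wordCons ω x)) /
        ∑ ω : Fin N → I, weight g ω := by
  have hW := sum_weight_pos g N
  rw [Measure.real, wordMeasure, Measure.finsetSum_apply, ENNReal.toReal_sum, Finset.sum_div]
  · refine Finset.sum_congr rfl fun ω _ => ?_
    rw [Measure.smul_apply, smul_eq_mul, Measure.dirac_apply' _ hA, ENNReal.toReal_mul,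
      ENNReal.toReal_ofReal (div_pos (weight_pos ω) hW).le, mul_div_right_comm]
    congr 1
    by_cases h : wordCons ω x ∈ A <;> simp [h]
  · intro ω _
    rw [Measure.smul_apply, smul_eq_mul]
    exact ENNReal.mul_ne_top ENNReal.ofReal_ne_top (measure_ne_top _ _)

theorem isProbabilityMeasure_wordMeasure (g : (ℕ → I) → ℝ) (x : ℕ → I) (N : ℕ) :
    IsProbabilityMeasure (wordMeasure g x N) := by
  have h := measureReal_wordMeasure g x N MeasurableSet.univ
  simp only [Set.indicator_univ, Pi.one_apply, mul_one] at h
  rw [div_self (sum_weight_pos g N).ne'] at h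
  refine ⟨?_⟩
  rwa [Measure.real, ENNReal.toReal_eq_one_iff] at h

theorem measureReal_wordMeasure_cylinder (g : (ℕ → I) → ℝ) (x : ℕ → I) {m : ℕ}
    (η : Fin m → I) (r : ℕ) : (wordMeasure g x (m + r)).real (cylinder η) =
      (∑ ν : Fin r → I, weight g (Fin.append η ν)) / ∑ ω : Fin (m + r) → I, weight g ω := by
  classical
  rw [measureReal_wordMeasure g x _ (measurableSet_cylinder η)]
  congr 1
  rw [sum_append, Finset.sum_eq_single η]
  · refine Finset.sum_congr rfl fun ν _ => ?_
    have h : wordCons (Fin.append η ν) x ∈ cylinder η :=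
      (mem_cylinder_append.1 (wordCons_mem_cylinder (Fin.append η ν) x)).1
    simp [h]
  · intro α _ hα
    refine Finset.sum_eq_zero fun ν _ => ?_
    have h : wordCons (Fin.append α ν) x ∉ cylinder η := fun hmem => hα <| by
      have h1 := (mem_cylinder_append.1 (wordCons_mem_cylinder (Fin.append α ν) x)).1
      exact (mem_cylinder_iff.1 h1).symm.trans (mem_cylinder_iff.1 hmem)
    simp [h]
  · simp

/-- In the lower bound one factor e^{−D} comes from splitting the word η ν and another from the
normalisation, whose total is at most e^D. The upper bound uses that the total is at least 1. -/
theorem wordMeasure_bounds (hg : IsHolder g) (hD : IsDistortionConst g D) (x : ℕ → I) {m : ℕ}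
    (η : Fin m → I) (r : ℕ) :
    Real.exp (-(2 * D)) * weight g η ≤ (wordMeasure g x (m + r)).real (cylinder η) ∧
      (wordMeasure g x (m + r)).real (cylinder η) ≤ Real.exp D * weight g η := by
  rw [measureReal_wordMeasure_cylinder]
  have hW := sum_weight_pos g (m + r)
  have hw := weight_pos (g := g) η
  constructor
  · rw [le_div_iff₀ hW]
    have h1 : weight g η ≤ Real.exp D * ∑ ν : Fin r → I, weight g (Fin.append η ν) := by
      calc weight g η ≤ weight g η * ∑ ν : Fin r → I, weight g ν :=
            le_mul_of_one_le_right hw.le (one_le_sum_weight hg r)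
        _ ≤ _ := by
          rw [Finset.mul_sum, Finset.mul_sum]
          exact Finset.sum_le_sum fun ν _ => weight_mul_le hD η ν
    calc Real.exp (-(2 * D)) * weight g η * ∑ ω : Fin (m + r) → I, weight g ω
        ≤ Real.exp (-(2 * D)) *
          (Real.exp D * ∑ ν : Fin r → I, weight g (Fin.append η ν)) * Real.exp D := by
          gcongr
          · exact mul_nonneg (Real.exp_pos _).le (mul_nonneg (Real.exp_pos _).le
              (Finset.sum_nonneg fun ν _ => (weight_pos _).le))
          · exact sum_weight_le hg hD _
      _ = Real.exp (-(2 * D)) * Real.exp D * Real.exp D *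
          ∑ ν : Fin r → I, weight g (Fin.append η ν) := by ring
      _ = _ := by
        rw [← Real.exp_add, ← Real.exp_add]
        ring_nf
        simp
  · rw [div_le_iff₀ hW]
    calc ∑ ν : Fin r → I, weight g (Fin.append η ν)
        ≤ ∑ ν : Fin r → I, weight g η * weight g ν :=
          Finset.sum_le_sum fun ν _ => weight_append_le hD η ν
      _ = weight g η * ∑ ν : Fin r → I, weight g ν := (Finset.mul_sum _ _ _).symm
      _ ≤ weight g η * Real.exp D := by gcongr; exact sum_weight_le hg hD r
      _ = Real.exp D * weight g η * 1 := by ring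
      _ ≤ _ := by gcongr; exact one_le_sum_weight hg _

theorem exists_weightBounds (hg : IsHolder g) (hD : IsDistortionConst g D) :
    ∃ μ : Measure (ℕ → I), IsProbabilityMeasure μ ∧ WeightBounds g (Real.exp (2 * D)) μ := by
  let _ : TopologicalSpace I := ⊥
  have _ : DiscreteTopology I := ⟨rfl⟩
  obtain ⟨i⟩ := ‹Nonempty I›
  have hp := isProbabilityMeasure_wordMeasure g fun _ => i
  obtain ⟨ν, hν⟩ := exists_tendsto_of_ultrafilter (hyperfilter ℕ)
    (fun N => ⟨wordMeasure g (fun _ => i) N, hp N⟩)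
  refine ⟨ν, inferInstance, fun m η => ?_⟩
  have hlim := tendsto_measureReal_of_isClopen hν (isClopen_cylinder η)
  have hev : ∀ᶠ N in (hyperfilter ℕ : Filter ℕ),
      Real.exp (-(2 * D)) * weight g η ≤ (wordMeasure g (fun _ => i) N).real (cylinder η) ∧
      (wordMeasure g (fun _ => i) N).real (cylinder η) ≤ Real.exp D * weight g η := by
    refine Nat.hyperfilter_le_atTop ((eventually_ge_atTop m).mono fun N hN => ?_)
    obtain ⟨r, rfl⟩ := Nat.exists_eq_add_of_le hN
    exact wordMeasure_bounds hg hD _ η r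
  have h1 := ge_of_tendsto hlim (hev.mono fun N h => h.1)
  have h2 := le_of_tendsto hlim (hev.mono fun N h => h.2)
  rw [Real.exp_neg, inv_mul_le_iff₀ (Real.exp_pos _)] at h1
  refine ⟨h1, h2.trans ?_⟩
  have := hD.nonneg
  exact mul_le_mul_of_nonneg_right (Real.exp_le_exp.2 (by linarith)) (weight_pos η).le

/-- The preimage of [η] under the k-th iterate is the union of the cylinders [αη] with |α| = k, and
the weights of the α sum to between 1 and e^D. The constant does not depend on k, so it survives
Cesàro averaging. -/
theorem WeightBounds.map_iterate {c : ℝ} {μ : Measure (ℕ → I)} [IsFiniteMeasure μ] (hc : 0 < c)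
    (h : WeightBounds g c μ) (hg : IsHolder g) (hD : IsDistortionConst g D) (k : ℕ) :
    WeightBounds g (c * Real.exp D) (μ.map shift^[k]) := by
  intro m η
  have hw := weight_pos (g := g) η
  rw [map_measureReal_apply (measurable_shift.iterate k) (measurableSet_cylinder η),
    ← sum_measureReal_cylinder_inter μ k (shift^[k] ⁻¹' cylinder η)]
  simp_rw [← cylinder_append]
  constructor
  · calc weight g η ≤ (∑ α : Fin k → I, weight g α) * weight g η :=
          le_mul_of_one_le_left hw.le (one_le_sum_weight hg k)
      _ ≤ _ := by
        rw [Finset.sum_mul, Finset.mul_sum]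
        refine Finset.sum_le_sum fun α _ => (weight_mul_le hD α η).trans ?_
        rw [mul_comm c, mul_assoc]
        exact mul_le_mul_of_nonneg_left (h _ _).1 (Real.exp_pos _).le
  · calc ∑ α : Fin k → I, μ.real (cylinder (Fin.append α η))
        ≤ ∑ α : Fin k → I, c * (weight g α * weight g η) :=
          Finset.sum_le_sum fun α _ => (h _ _).2.trans
            (mul_le_mul_of_nonneg_left (weight_append_le hD α η) hc.le)
      _ = c * ((∑ α : Fin k → I, weight g α) * weight g η) := by
        rw [Finset.sum_mul, Finset.mul_sum]
      _ ≤ c * (Real.exp D * weight g η) := by gcongr; exact sum_weight_le hg hD k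
      _ = _ := by ring

/-- The Cesàro averages of the images of `μ` under the iterates of the shift. -/
def cesaroMeasure (μ : Measure (ℕ → I)) (n : ℕ) : Measure (ℕ → I) :=
  ENNReal.ofReal ((n + 1 : ℝ)⁻¹) • ∑ k ∈ Finset.range (n + 1), μ.map shift^[k]

theorem measureReal_cesaroMeasure (μ : Measure (ℕ → I)) [IsFiniteMeasure μ] (n : ℕ)
    (A : Set (ℕ → I)) : (cesaroMeasure μ n).real A =
      (n + 1 : ℝ)⁻¹ * ∑ k ∈ Finset.range (n + 1), (μ.map shift^[k]).real A := by
  rw [cesaroMeasure, measureReal_ennreal_smul_apply, ENNReal.toReal_ofReal (by positivity)]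
  congr 1
  rw [Measure.real, Measure.finsetSum_apply, ENNReal.toReal_sum]
  · rfl
  · exact fun k _ => measure_ne_top _ _

theorem isProbabilityMeasure_cesaroMeasure (μ : Measure (ℕ → I)) [IsProbabilityMeasure μ]
    (n : ℕ) : IsProbabilityMeasure (cesaroMeasure μ n) := by
  have h := measureReal_cesaroMeasure μ n Set.univ
  have hk : ∀ k, (μ.map shift^[k]).real Set.univ = 1 := fun k => by
    rw [map_measureReal_apply (measurable_shift.iterate k) MeasurableSet.univ]
    simp
  simp only [hk, Finset.sum_const, Finset.card_range, nsmul_eq_mul, mul_one] at h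
  push_cast at h
  rw [inv_mul_cancel₀ (by positivity)] at h
  refine ⟨?_⟩
  rwa [Measure.real, ENNReal.toReal_eq_one_iff] at h

theorem WeightBounds.cesaroMeasure {c : ℝ} {μ : Measure (ℕ → I)} [IsFiniteMeasure μ]
    (h : ∀ k, WeightBounds g c (μ.map shift^[k])) (n : ℕ) :
    WeightBounds g c (cesaroMeasure μ n) := by
  intro m η
  have hn : (0 : ℝ) < n + 1 := by positivity
  rw [measureReal_cesaroMeasure]
  constructor
  · rw [mul_left_comm, le_inv_mul_iff₀ hn, Finset.mul_sum]
    calc (n + 1 : ℝ) * weight g η = ∑ k ∈ Finset.range (n + 1), weight g η := by simp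
      _ ≤ _ := Finset.sum_le_sum fun k _ => (h k m η).1
  · rw [inv_mul_le_iff₀ hn]
    refine (Finset.sum_le_sum fun k _ => (h k m η).2).trans_eq ?_
    simp

theorem abs_measureReal_cesaroMeasure_sub_le (μ : Measure (ℕ → I)) [IsProbabilityMeasure μ]
    (n : ℕ) {A : Set (ℕ → I)} (hA : MeasurableSet A) :
    |(cesaroMeasure μ n).real (shift ⁻¹' A) - (cesaroMeasure μ n).real A| ≤
      (n + 1 : ℝ)⁻¹ := by
  have hk : ∀ k, (μ.map shift^[k]).real (shift ⁻¹' A) = (μ.map shift^[k + 1]).real A := by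
    intro k
    rw [map_measureReal_apply (measurable_shift.iterate _) hA,
      map_measureReal_apply (measurable_shift.iterate _) (measurable_shift hA),
      Function.iterate_succ', Set.preimage_comp]
  have hle : ∀ k, (μ.map shift^[k]).real A ≤ 1 := fun k => by
    rw [map_measureReal_apply (measurable_shift.iterate _) hA]
    exact measureReal_le_one
  rw [measureReal_cesaroMeasure, measureReal_cesaroMeasure, ← mul_sub,
    ← Finset.sum_sub_distrib, abs_mul, abs_of_pos (by positivity : (0 : ℝ) < (n + 1 : ℝ)⁻¹)]
  simp_rw [hk]
  rw [Finset.sum_range_sub (fun k => (μ.map shift^[k]).real A)]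
  refine mul_le_of_le_one_right (by positivity) (abs_le.2 ⟨?_, ?_⟩)
  · linarith [hle 0, measureReal_nonneg (μ := μ.map shift^[n + 1]) (s := A)]
  · linarith [hle (n + 1), measureReal_nonneg (μ := μ.map shift^[0]) (s := A)]

theorem measurePreserving_of_cylinder {μ : Measure (ℕ → I)} [IsFiniteMeasure μ]
    (h : ∀ (n : ℕ) (ω : Fin n → I), μ.real (shift ⁻¹' cylinder ω) = μ.real (cylinder ω)) :
    MeasurePreserving shift μ μ :=
  ⟨measurable_shift, measure_ext_of_cylinder fun n ω => by
    rw [map_measureReal_apply measurable_shift (measurableSet_cylinder ω), h]⟩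

/-- Krylov–Bogolyubov: a weak limit of Cesàro averages is invariant, and the uniform Gibbs bounds
pass to the limit because cylinders are clopen. -/
theorem exists_invariant_weightBounds (hg : IsHolder g) (hD : IsDistortionConst g D) :
    ∃ μ : Measure (ℕ → I), IsProbabilityMeasure μ ∧ MeasurePreserving shift μ μ ∧
      WeightBounds g (Real.exp (3 * D)) μ := by
  let _ : TopologicalSpace I := ⊥
  have _ : DiscreteTopology I := ⟨rfl⟩
  obtain ⟨μ, _, hμ⟩ := exists_weightBounds hg hD
  obtain ⟨ν, hν⟩ := exists_tendsto_of_ultrafilter (hyperfilter ℕ)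
    (fun n => ⟨cesaroMeasure μ n, isProbabilityMeasure_cesaroMeasure μ n⟩)
  have hlim := fun {A : Set (ℕ → I)} (hA : IsClopen A) => tendsto_measureReal_of_isClopen hν hA
  refine ⟨ν, inferInstance, measurePreserving_of_cylinder fun m η => ?_, fun m η => ?_⟩
  · have h1 := ((hlim ((isClopen_cylinder η).preimage continuous_shift)).sub
      (hlim (isClopen_cylinder η))).abs
    have h2 : Tendsto (fun n : ℕ => (n + 1 : ℝ)⁻¹) (hyperfilter ℕ : Filter ℕ) (𝓝 0) :=
      (tendsto_one_div_add_atTop_nhds_zero_nat.congr fun n => one_div _).mono_left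
        Nat.hyperfilter_le_atTop
    have h3 := le_of_tendsto_of_tendsto' h1 h2 fun n =>
      abs_measureReal_cesaroMeasure_sub_le μ n (measurableSet_cylinder η)
    exact sub_eq_zero.1 (abs_eq_zero.1 (le_antisymm h3 (abs_nonneg _)))
  · have hb := WeightBounds.cesaroMeasure fun k => hμ.map_iterate (Real.exp_pos _) hg hD k
    rw [← Real.exp_add, show 2 * D + D = 3 * D by ring] at hb
    exact ⟨ge_of_tendsto' ((hlim (isClopen_cylinder η)).const_mul _) fun n => (hb n m η).1,
      le_of_tendsto' (hlim (isClopen_cylinder η)) fun n => (hb n m η).2⟩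

theorem existsUnique_isGibbsMeasure (hg : IsHolder g) :
    ∃! μ : Measure (ℕ → I), IsGibbsMeasure g μ := by
  obtain ⟨D, hD⟩ := hg.exists_distortion
  obtain ⟨μ, _, hinv, hμ⟩ := exists_invariant_weightBounds hg hD
  have hG := hμ.isGibbsMeasure hD hinv (Real.exp_pos _)
  refine ⟨μ, hG, fun ν hν => ?_⟩
  have _ := hν.isProbabilityMeasure
  exact hν.eq hD hG

theorem isGibbsMeasure_gibbsMeasure (hg : IsHolder g) : IsGibbsMeasure g (gibbsMeasure g) := by
  have h := (existsUnique_isGibbsMeasure hg).exists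
  rw [gibbsMeasure, dif_pos h]
  exact h.choose_spec

theorem weightBounds_gibbsMeasure (hg : IsHolder g) (hD : IsDistortionConst g D) :
    WeightBounds g (Real.exp (3 * D)) (gibbsMeasure g) := by
  obtain ⟨μ, _, hinv, hμ⟩ := exists_invariant_weightBounds hg hD
  have hG := hμ.isGibbsMeasure hD hinv (Real.exp_pos _)
  rwa [← hG.eq hD (isGibbsMeasure_gibbsMeasure hg)]

end Existence

/-! ### The pressure function `s ↦ P(sψ + f)` and the integrals `∫ ψ dμ_{sψ + f}` -/

section PressureFunction

variable [Fintype I] [Nonempty I] [MeasurableSpace I] [DiscreteMeasurableSpace I]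
  {f ψ : (ℕ → I) → ℝ}

theorem IsHolder.measurable (hψ : IsHolder ψ) : Measurable ψ := by
  let _ : TopologicalSpace I := ⊥
  have _ : DiscreteTopology I := ⟨rfl⟩
  exact hψ.continuous.measurable

theorem IsHolder.integrable (hψ : IsHolder ψ) (μ : Measure (ℕ → I)) [IsFiniteMeasure μ] :
    Integrable ψ μ := by
  obtain ⟨M, -, hM⟩ := hψ.bounded
  exact Integrable.of_bound hψ.measurable.aestronglyMeasurable M (ae_of_all _ hM)

theorem measurable_birkhoffSum (hψ : Measurable ψ) (n : ℕ) :
    Measurable (birkhoffSum shift ψ n) :=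
  Finset.measurable_sum _ fun k _ => hψ.comp (measurable_shift.iterate k)

theorem integral_birkhoffSum (hψ : IsHolder ψ) {μ : Measure (ℕ → I)} [IsFiniteMeasure μ]
    (hμ : MeasurePreserving shift μ μ) (n : ℕ) :
    Integrable (birkhoffSum shift ψ n) μ ∧
      ∫ x, birkhoffSum shift ψ n x ∂μ = n * ∫ x, ψ x ∂μ := by
  have hi : ∀ k, Integrable (fun x => ψ (shift^[k] x)) μ := fun k =>
    (hμ.iterate k).integrable_comp_of_integrable (hψ.integrable μ)
  have hk : ∀ k, ∫ x, ψ (shift^[k] x) ∂μ = ∫ x, ψ x ∂μ := fun k => by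
    rw [← integral_map (hμ.iterate k).measurable.aemeasurable
      (by rw [(hμ.iterate k).map_eq]; exact hψ.measurable.aestronglyMeasurable),
      (hμ.iterate k).map_eq]
  unfold birkhoffSum
  refine ⟨integrable_finsetSum _ fun k _ => hi k, ?_⟩
  rw [integral_finsetSum _ fun k _ => hi k]
  simp [hk]

theorem integral_le_sum_of_cylinder {μ : Measure (ℕ → I)} [IsFiniteMeasure μ]
    {h : (ℕ → I) → ℝ} (hh : Integrable h μ) {n : ℕ} {B : (Fin n → I) → ℝ}
    (hpos : ∀ ω : Fin n → I, 0 < μ.real (cylinder ω))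
    (hB : ∀ ω, ∀ x ∈ cylinder ω, h x * μ.real (cylinder ω) ≤ B ω) :
    ∫ x, h x ∂μ ≤ ∑ ω, B ω := by
  have hU : (⋃ ω : Fin n → I, cylinder ω) = Set.univ := by
    ext x; simp [mem_cylinder_iff]
  rw [← setIntegral_univ, ← hU, integral_iUnion_fintype (fun ω => measurableSet_cylinder ω)]
  · refine Finset.sum_le_sum fun ω _ => ?_
    calc ∫ x in cylinder ω, h x ∂μ ≤ ∫ x in cylinder ω, B ω / μ.real (cylinder ω) ∂μ :=
          setIntegral_mono_on hh.integrableOn (integrable_const _) (measurableSet_cylinder ω)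
            fun x hx => (le_div_iff₀ (hpos ω)).2 (hB ω x hx)
      _ = B ω := by
        rw [setIntegral_const, smul_eq_mul, mul_div_cancel₀ _ (hpos ω).ne']
  · intro ω ν hne
    refine Set.disjoint_left.2 fun x hx hy => hne ?_
    exact (mem_cylinder_iff.1 hx).symm.trans (mem_cylinder_iff.1 hy)
  · exact fun ω => hh.integrableOn

/-- The integral of ψ is a subgradient of the pressure function at t. Jensen's inequality bounds
exp((s−t) n ∫ψ) by the μ_t-integral of exp((s−t) S_n ψ), which by the Gibbs bounds is at most a
constant times e^{−nP(t)} Z_n(sψ+f). -/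
theorem pressure_add_mul_integral_le (hf : IsHolder f) (hψ : IsHolder ψ) (s t : ℝ) :
    pressure (t • ψ + f) + (s - t) * ∫ x, ψ x ∂gibbsMeasure (t • ψ + f) ≤
      pressure (s • ψ + f) := by
  have hG := isGibbsMeasure_gibbsMeasure (hf.smul_add hψ t)
  set μ := gibbsMeasure (t • ψ + f) with hμ
  have _ := hG.isProbabilityMeasure
  obtain ⟨D, hD⟩ := (hf.smul_add hψ t).exists_distortion
  obtain ⟨E, hE⟩ := (hf.smul_add hψ s).exists_distortion
  have hb := weightBounds_gibbsMeasure (hf.smul_add hψ t) hD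
  have hpos := fun (n : ℕ) (ω : Fin n → I) =>
    hb.measureReal_cylinder_pos (Real.exp_pos _) ω
  have key : ∀ n : ℕ, n * (pressure (t • ψ + f) + (s - t) * ∫ x, ψ x ∂μ) ≤
      4 * D + Real.log (partitionSum (s • ψ + f) Set.univ n) := by
    intro n
    obtain ⟨hi, hint⟩ := integral_birkhoffSum hψ hG.invariant n
    obtain ⟨M, hM0, hM⟩ := hψ.bounded
    have hexp : Integrable (fun x => Real.exp ((s - t) * birkhoffSum shift ψ n x)) μ := by
      refine Integrable.of_bound (Real.measurable_exp.comp
        ((measurable_birkhoffSum hψ.measurable n).const_mul _)).aestronglyMeasurable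
        (Real.exp (|s - t| * (n * M))) (ae_of_all _ fun x => ?_)
      rw [Real.norm_eq_abs, Real.abs_exp, Real.exp_le_exp]
      refine (le_abs_self _).trans ?_
      rw [abs_mul]
      exact mul_le_mul_of_nonneg_left (abs_birkhoffSum_le hM n x) (abs_nonneg _)
    have hJ : Real.exp ((s - t) * (n * ∫ x, ψ x ∂μ)) ≤
        ∫ x, Real.exp ((s - t) * birkhoffSum shift ψ n x) ∂μ := by
      have := convexOn_exp.map_integral_le (μ := μ) Real.continuous_exp.continuousOn
        isClosed_univ (ae_of_all _ fun _ => Set.mem_univ _) (hi.const_mul (s - t)) hexp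
      rwa [integral_const_mul, hint] at this
    have hsum : ∫ x, Real.exp ((s - t) * birkhoffSum shift ψ n x) ∂μ ≤
        ∑ ω : Fin n → I, Real.exp (4 * D - n * pressure (t • ψ + f)) *
          Real.exp (supSum (s • ψ + f) ω) := by
      -- The constant 4D is 3D from the Gibbs bounds plus D for replacing a supremum by the value at
      -- x.
      refine integral_le_sum_of_cylinder hexp (hpos n) fun ω x hx => ?_
      refine (mul_le_mul_of_nonneg_left (hb n ω).2 (Real.exp_pos _).le).trans ?_
      rw [weight, ← Real.exp_add, ← Real.exp_add, ← Real.exp_add, Real.exp_le_exp]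
      have h1 := supSum_le_birkhoffSum_add hD hx
      have h2 := birkhoffSum_le_supSum hE hx
      rw [birkhoffSum_smul_add] at h1 h2
      linarith
    rw [← Finset.mul_sum, ← partitionSum_univ] at hsum
    have h3 := Real.log_le_log (Real.exp_pos _) (hJ.trans hsum)
    rw [Real.log_exp, Real.log_mul (Real.exp_pos _).ne'
      (partitionSum_pos _ Set.univ_nonempty n).ne', Real.log_exp] at h3
    linarith
  have hlim := (tendsto_const_div_atTop_nhds_zero_nat (4 * D)).add
    (tendsto_pressure (hf.smul_add hψ s))
  rw [zero_add] at hlim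
  refine ge_of_tendsto hlim ?_
  filter_upwards [eventually_gt_atTop 0] with n hn
  have hn' : (0 : ℝ) < n := by exact_mod_cast hn
  rw [← add_div, le_div_iff₀ hn']
  linarith [key n]

theorem abs_pressure_sub_le (hf : IsHolder f) (hψ : IsHolder ψ) {M : ℝ} (hM : ∀ x, |ψ x| ≤ M)
    (s t : ℝ) : |pressure (s • ψ + f) - pressure (t • ψ + f)| ≤ |s - t| * M := by
  have h : ∀ s t : ℝ, pressure (s • ψ + f) ≤ pressure (t • ψ + f) + |s - t| * M := by
    intro s t
    refine pressure_le_add_of_forall_le (hf.smul_add hψ s) (hf.smul_add hψ t) fun x => ?_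
    have h1 : (s - t) * ψ x ≤ |s - t| * M := by
      refine (le_abs_self _).trans ?_
      rw [abs_mul]
      exact mul_le_mul_of_nonneg_left (hM x) (abs_nonneg _)
    simp only [Pi.add_apply, Pi.smul_apply, smul_eq_mul]
    linarith
  have h1 := h s t
  have h2 := h t s
  rw [abs_sub_comm t s] at h2
  exact abs_le.2 ⟨by linarith, by linarith⟩

theorem continuous_pressure (hf : IsHolder f) (hψ : IsHolder ψ) :
    Continuous fun s : ℝ => pressure (s • ψ + f) := by
  obtain ⟨M, hM0, hM⟩ := hψ.bounded
  refine (LipschitzWith.of_dist_le_mul (K := M.toNNReal) fun s t => ?_).continuous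
  rw [Real.dist_eq, Real.dist_eq, Real.coe_toNNReal M hM0, mul_comm M]
  exact abs_pressure_sub_le hf hψ hM s t

theorem tendsto_weight (hf : IsHolder f) (hψ : IsHolder ψ) {n : ℕ} (ω : Fin n → I) (t : ℝ) :
    Tendsto (fun s : ℝ => weight (s • ψ + f) ω) (𝓝 t) (𝓝 (weight (t • ψ + f) ω)) := by
  obtain ⟨M, hM0, hM⟩ := hψ.bounded
  have hsup : ∀ s t : ℝ, supSum (s • ψ + f) ω ≤ supSum (t • ψ + f) ω + |s - t| * (n * M) := by
    intro s t
    obtain ⟨D, hD⟩ := (hf.smul_add hψ t).exists_distortion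
    refine supSum_le_of_forall fun x hx => ?_
    have h1 := birkhoffSum_le_supSum hD hx
    have h2 : (s - t) * birkhoffSum shift ψ n x ≤ |s - t| * (n * M) := by
      refine (le_abs_self _).trans ?_
      rw [abs_mul]
      exact mul_le_mul_of_nonneg_left (abs_birkhoffSum_le hM n x) (abs_nonneg _)
    rw [birkhoffSum_smul_add] at h1 ⊢
    linarith
  have hc : Continuous fun s : ℝ => supSum (s • ψ + f) ω := by
    refine (LipschitzWith.of_dist_le_mul (K := (n * M).toNNReal) fun s t => ?_).continuous
    rw [Real.dist_eq, Real.dist_eq, Real.coe_toNNReal _ (by positivity), mul_comm (n * M)]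
    have h1 := hsup s t
    have h2 := hsup t s
    rw [abs_sub_comm t s] at h2
    exact abs_le.2 ⟨by linarith, by linarith⟩
  exact (Real.continuous_exp.comp
    (hc.sub (continuous_const.mul (continuous_pressure hf hψ)))).tendsto t

theorem WeightBounds.mono {g : (ℕ → I) → ℝ} {c c' : ℝ} {μ : Measure (ℕ → I)}
    (h : WeightBounds g c μ) (hc : c ≤ c') : WeightBounds g c' μ := fun n ω =>
  ⟨(h n ω).1.trans (mul_le_mul_of_nonneg_right hc measureReal_nonneg),
    (h n ω).2.trans (mul_le_mul_of_nonneg_right hc (weight_pos ω).le)⟩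

/-- Gibbs bounds are uniform for parameters near t and weights are continuous in the parameter, so
every weak limit of μ_s as s → t is an invariant measure with Gibbs bounds for tψ+f. By uniqueness
it is μ_t. -/
theorem continuous_integral_gibbsMeasure (hf : IsHolder f) (hψ : IsHolder ψ) :
    Continuous fun s : ℝ => ∫ x, ψ x ∂gibbsMeasure (s • ψ + f) := by
  let _ : TopologicalSpace I := ⊥
  have _ : DiscreteTopology I := ⟨rfl⟩
  rw [continuous_iff_continuousAt]
  intro t
  rw [ContinuousAt, tendsto_iff_ultrafilter]
  intro U hU
  have hG := fun s : ℝ => isGibbsMeasure_gibbsMeasure (hf.smul_add hψ s)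
  obtain ⟨D, hD⟩ := hf.exists_distortion
  obtain ⟨E, hE⟩ := hψ.exists_distortion
  have hE0 := hE.nonneg
  obtain ⟨ν, hν⟩ := exists_tendsto_of_ultrafilter U
    (fun s : ℝ => ⟨gibbsMeasure (s • ψ + f), (hG s).isProbabilityMeasure⟩)
  have hlim := fun {A : Set (ℕ → I)} (hA : IsClopen A) => tendsto_measureReal_of_isClopen hν hA
  have hinv : MeasurePreserving shift (ν : Measure (ℕ → I)) ν := by
    refine measurePreserving_of_cylinder fun n ω => tendsto_nhds_unique
      (hlim ((isClopen_cylinder ω).preimage continuous_shift)) ?_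
    refine (hlim (isClopen_cylinder ω)).congr fun s => ?_
    exact ((hG s).invariant.measureReal_preimage
      (measurableSet_cylinder ω).nullMeasurableSet).symm
  set c := Real.exp (3 * ((|t| + 1) * E + D)) with hc
  have hbound : ∀ᶠ s in (U : Filter ℝ),
      WeightBounds (s • ψ + f) c (gibbsMeasure (s • ψ + f)) := by
    refine hU ?_
    filter_upwards [Metric.ball_mem_nhds t one_pos] with s hs
    refine (weightBounds_gibbsMeasure (hf.smul_add hψ s) (hD.smul_add hE s)).mono ?_
    rw [hc, Real.exp_le_exp]
    have hs' : |s| ≤ |t| + 1 := by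
      have h1 := abs_sub_abs_le_abs_sub s t
      rw [Metric.mem_ball, Real.dist_eq] at hs
      linarith
    gcongr
  have hb : WeightBounds (t • ψ + f) c ν := fun n ω => by
    have hw := (tendsto_weight hf hψ ω t).mono_left hU
    have hm := hlim (isClopen_cylinder ω)
    exact ⟨le_of_tendsto_of_tendsto hw (hm.const_mul c) (hbound.mono fun s h => (h n ω).1),
      le_of_tendsto_of_tendsto hm (hw.const_mul c) (hbound.mono fun s h => (h n ω).2)⟩
  have hνG := hb.isGibbsMeasure (hD.smul_add hE t) hinv (Real.exp_pos _)
  rw [← hνG.eq (hD.smul_add hE t) (hG t)]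
  let ψb : BoundedContinuousFunction (ℕ → I) ℝ :=
    BoundedContinuousFunction.mkOfCompact ⟨ψ, hψ.continuous⟩
  exact (ProbabilityMeasure.tendsto_iff_forall_integral_tendsto.1 hν) ψb

/-- The partition sum contains the word of any given orbit, so P(s) is at least the limiting
averages of sψ+f along it. One orbit has averages of ψ frequently above a positive number, another
frequently below a negative one; they serve s ≥ 0 and s ≤ 0 respectively. -/
theorem exists_lt_mul_abs_le_pressure (hf : IsHolder f) (hψ : IsHolder ψ)
    (h0 : 0 ∈ Set.Ioo (lowerAvg ψ) (upperAvg ψ)) :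
    ∃ ε > 0, ∃ M : ℝ, ∀ s : ℝ, |s| * ε - M ≤ pressure (s • ψ + f) := by
  obtain ⟨A, -, hA⟩ := hψ.bounded
  obtain ⟨M, -, hM⟩ := hf.bounded
  have hbd : ∀ x : ℕ → I, ∀ n : ℕ, |birkhoffSum shift ψ n x / n| ≤ |A| := fun x n => by
    rcases Nat.eq_zero_or_pos n with rfl | hn
    · simp
    have hn' : (0 : ℝ) < n := by exact_mod_cast hn
    rw [abs_div, abs_of_pos hn', div_le_iff₀ hn', mul_comm]
    exact (abs_birkhoffSum_le hA n x).trans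
      (mul_le_mul_of_nonneg_left (le_abs_self A) hn'.le)
  obtain ⟨x, hx⟩ := exists_lt_of_ciInf_lt h0.1
  obtain ⟨y, hy⟩ := exists_lt_of_lt_ciSup h0.2
  obtain ⟨ε₁, hε₁, hε₁'⟩ := exists_between hx
  obtain ⟨ε₂, hε₂, hε₂'⟩ := exists_between hy
  have hfx : ∃ᶠ n : ℕ in atTop, birkhoffSum shift ψ n x / n < ε₁ :=
    frequently_lt_of_liminf_lt
      ((isBoundedUnder_of ⟨|A|, fun n => (abs_le.1 (hbd x n)).2⟩ :
          IsBoundedUnder (· ≤ ·) atTop _).isCoboundedUnder_ge) hε₁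
  have hfy : ∃ᶠ n : ℕ in atTop, ε₂ < birkhoffSum shift ψ n y / n :=
    frequently_lt_of_lt_limsup
      ((isBoundedUnder_of ⟨-|A|, fun n => (abs_le.1 (hbd y n)).1⟩ :
          IsBoundedUnder (· ≥ ·) atTop _).isCoboundedUnder_le) hε₂'
  have hgen : ∀ (s : ℝ) (z : ℕ → I) (n : ℕ), 0 < n →
      s * (birkhoffSum shift ψ n z / n) - M ≤ birkhoffSum shift (s • ψ + f) n z / n := by
    intro s z n hn
    have hn' : (0 : ℝ) < n := by exact_mod_cast hn
    rw [le_div_iff₀ hn', birkhoffSum_smul_add, sub_mul, mul_assoc, div_mul_cancel₀ _ hn'.ne']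
    linarith [(abs_le.1 (abs_birkhoffSum_le hM n z)).1]
  refine ⟨min (-ε₁) ε₂, lt_min (by linarith) hε₂, M, fun s => ?_⟩
  rcases le_total 0 s with hs | hs
  · refine le_pressure_of_frequently (hf.smul_add hψ s) (x := y) ?_
    refine (hfy.and_eventually (eventually_gt_atTop 0)).mono fun n hn => ?_
    refine le_trans ?_ (hgen s y n hn.2)
    rw [abs_of_nonneg hs]
    have := mul_le_mul_of_nonneg_left ((min_le_right (-ε₁) ε₂).trans hn.1.le) hs
    linarith
  · refine le_pressure_of_frequently (hf.smul_add hψ s) (x := x) ?_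
    refine (hfx.and_eventually (eventually_gt_atTop 0)).mono fun n hn => ?_
    refine le_trans ?_ (hgen s x n hn.2)
    rw [abs_of_nonpos hs]
    have := mul_le_mul_of_nonneg_left
      ((min_le_left (-ε₁) ε₂).trans (neg_le_neg hn.1.le)) (neg_nonneg.2 hs)
    linarith

theorem exists_integral_gibbsMeasure_eq_zero (hf : IsHolder f) (hψ : IsHolder ψ)
    (h0 : 0 ∈ Set.Ioo (lowerAvg ψ) (upperAvg ψ)) :
    ∃ t : ℝ, ∫ x, ψ x ∂gibbsMeasure (t • ψ + f) = 0 := by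
  obtain ⟨ε, hε, M, hM⟩ := exists_lt_mul_abs_le_pressure hf hψ h0
  set r : ℝ := (|pressure ((0 : ℝ) • ψ + f)| + |M|) / ε with hr
  have hr0 : 0 ≤ r := by positivity
  have hrε : r * ε = |pressure ((0 : ℝ) • ψ + f)| + |M| := div_mul_cancel₀ _ hε.ne'
  -- The subgradient inequality at s, evaluated at 0, gives s∫ψ dμ_s ≥ P(s) − P(0), which linear
  -- growth makes positive for large |s|. The integral thus changes sign.
  have hsub : ∀ s, r < |s| → 0 < s * ∫ x, ψ x ∂gibbsMeasure (s • ψ + f) := by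
    intro s hs
    have h1 := pressure_add_mul_integral_le hf hψ 0 s
    have h2 := hM s
    have h3 : r * ε < |s| * ε := by gcongr
    have h4 := le_abs_self (pressure ((0 : ℝ) • ψ + f))
    have h5 := le_abs_self M
    linarith
  have hpos := hsub (r + 1) (by rw [abs_of_nonneg (by linarith)]; linarith)
  have hneg := hsub (-(r + 1)) (by rw [abs_neg, abs_of_nonneg (by linarith)]; linarith)
  refine mem_range_of_exists_le_of_exists_ge (continuous_integral_gibbsMeasure hf hψ)
    ⟨-(r + 1), ?_⟩ ⟨r + 1, ?_⟩
  · by_contra! h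
    nlinarith
  · exact (pos_of_mul_pos_right hpos (by linarith)).le

theorem isLeast_pressure (hf : IsHolder f) (hψ : IsHolder ψ) {t : ℝ}
    (ht : ∫ x, ψ x ∂gibbsMeasure (t • ψ + f) = 0) :
    IsLeast (Set.range fun s : ℝ => pressure (s • ψ + f)) (pressure (t • ψ + f)) := by
  refine ⟨⟨t, rfl⟩, ?_⟩
  rintro _ ⟨s, rfl⟩
  simpa [ht] using pressure_add_mul_integral_le hf hψ s t

end PressureFunction

/-! ### Uniqueness of the parameter with vanishing integral -/

section Uniqueness

variable [Fintype I] [Nonempty I] [MeasurableSpace I] [DiscreteMeasurableSpace I]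
  {f ψ : (ℕ → I) → ℝ}

theorem lowerAvg_eq_zero_of_abs_birkhoffSum_le {B : ℝ}
    (hB : ∀ n x, |birkhoffSum shift ψ n x| ≤ B) : lowerAvg ψ = 0 := by
  have h : ∀ x : ℕ → I, liminf (fun n : ℕ => birkhoffSum shift ψ n x / n) atTop = 0 := by
    intro x
    refine Tendsto.liminf_eq (squeeze_zero_norm (fun n => ?_)
      (tendsto_const_div_atTop_nhds_zero_nat B))
    rw [Real.norm_eq_abs, abs_div, Nat.abs_cast]
    exact div_le_div_of_nonneg_right (hB n x) n.cast_nonneg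
  simp [lowerAvg, h]

/-- If the measures agreed, the weights would be comparable; with equal pressures this bounds (s−t)
S_n ψ uniformly, so all averages of ψ would tend to 0. -/
theorem gibbsMeasure_ne (hf : IsHolder f) (hψ : IsHolder ψ) (h0 : lowerAvg ψ ≠ 0) {s t : ℝ}
    (hst : s ≠ t) (hp : pressure (s • ψ + f) = pressure (t • ψ + f)) :
    gibbsMeasure (s • ψ + f) ≠ gibbsMeasure (t • ψ + f) := by
  intro heq
  obtain ⟨D, hD⟩ := (hf.smul_add hψ s).exists_distortion
  obtain ⟨E, hE⟩ := (hf.smul_add hψ t).exists_distortion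
  have hs := weightBounds_gibbsMeasure (hf.smul_add hψ s) hD
  have ht := weightBounds_gibbsMeasure (hf.smul_add hψ t) hE
  rw [heq] at hs
  have hw : ∀ (n : ℕ) (ω : Fin n → I),
      |supSum (s • ψ + f) ω - supSum (t • ψ + f) ω| ≤ 3 * D + 3 * E := by
    intro n ω
    have h1 : weight (s • ψ + f) ω ≤
        Real.exp (3 * D) * (Real.exp (3 * E) * weight (t • ψ + f) ω) :=
      (hs n ω).1.trans (mul_le_mul_of_nonneg_left (ht n ω).2 (Real.exp_pos _).le)
    have h2 : weight (t • ψ + f) ω ≤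
        Real.exp (3 * E) * (Real.exp (3 * D) * weight (s • ψ + f) ω) :=
      (ht n ω).1.trans (mul_le_mul_of_nonneg_left (hs n ω).2 (Real.exp_pos _).le)
    rw [weight, weight, hp, ← Real.exp_add, ← Real.exp_add, Real.exp_le_exp] at h1 h2
    exact abs_le.2 ⟨by linarith, by linarith⟩
  have hpos : 0 < |s - t| := abs_pos.2 (sub_ne_zero.2 hst)
  refine h0 (lowerAvg_eq_zero_of_abs_birkhoffSum_le (B := (4 * D + 4 * E) / |s - t|)
    fun n x => ?_)
  rw [le_div_iff₀ hpos, mul_comm, ← abs_mul]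
  have hx := mem_cylinder_prefixWord n x
  have h1 := birkhoffSum_le_supSum hD hx
  have h2 := supSum_le_birkhoffSum_add hD hx
  have h3 := birkhoffSum_le_supSum hE hx
  have h4 := supSum_le_birkhoffSum_add hE hx
  have h5 := abs_le.1 (hw n (prefixWord n x))
  rw [birkhoffSum_smul_add] at h1 h2 h3 h4
  exact abs_le.2 ⟨by linarith [hD.nonneg, hE.nonneg], by linarith [hD.nonneg, hE.nonneg]⟩

/-- The singular part of μ relative to ν is invariant and dominated by μ, hence a multiple cμ. If c
= 0 then μ ≪ ν and ergodicity of ν gives equality; otherwise μ itself is singular. -/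
theorem eq_or_mutuallySingular_of_ergodic {X : Type*} [MeasurableSpace X] {T : X → X}
    {μ ν : Measure X} [IsProbabilityMeasure μ] [IsProbabilityMeasure ν] (hμ : Ergodic T μ)
    (hν : Ergodic T ν) : μ = ν ∨ μ ⟂ₘ ν := by
  have hinv := hμ.toMeasurePreserving.singularPart hν.toMeasurePreserving
  obtain ⟨c, hc⟩ := hμ.eq_smul_of_absolutelyContinuous hinv
    (Measure.absolutelyContinuous_of_le (Measure.singularPart_le μ ν))
  by_cases h0 : c = 0
  · rw [h0, zero_smul, Measure.singularPart_eq_zero] at hc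
    exact Or.inl (hν.eq_of_absolutelyContinuous hμ.toMeasurePreserving hc)
  · have h1 := Measure.mutuallySingular_singularPart μ ν
    rw [hc] at h1
    exact Or.inr (h1.mono_ac (Measure.absolutelyContinuous_smul h0) .rfl)

theorem eq_of_integral_gibbsMeasure_eq_zero (hf : IsHolder f) (hψ : IsHolder ψ)
    (h0 : lowerAvg ψ ≠ 0) {s t : ℝ} (hs : ∫ x, ψ x ∂gibbsMeasure (s • ψ + f) = 0)
    (ht : ∫ x, ψ x ∂gibbsMeasure (t • ψ + f) = 0) : s = t := by
  by_contra hst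
  set u : ℝ := (s + t) / 2 with hu
  have hus : u ≠ s := fun h => hst (by linarith)
  have hut : u ≠ t := fun h => hst (by linarith)
  have h1 := (isLeast_pressure hf hψ hs).2 ⟨t, rfl⟩
  have h2 := (isLeast_pressure hf hψ ht).2 ⟨s, rfl⟩
  have h3 := (isLeast_pressure hf hψ hs).2 ⟨u, rfl⟩
  have h4 := pressure_add_mul_integral_le hf hψ s u
  have h5 := pressure_add_mul_integral_le hf hψ t u
  have h6 : (s - u) * (∫ x, ψ x ∂gibbsMeasure (u • ψ + f)) +
      (t - u) * (∫ x, ψ x ∂gibbsMeasure (u • ψ + f)) = 0 := by rw [hu]; ring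
  simp only at h1 h2 h3
  -- Adding the subgradient inequalities at the midpoint gives 2P(u) ≤ P(s) + P(t), while P(s) =
  -- P(t) is the minimum.
  have hps : pressure (u • ψ + f) = pressure (s • ψ + f) := by linarith
  have hpt : pressure (u • ψ + f) = pressure (t • ψ + f) := by linarith
  have hG := fun r : ℝ => isGibbsMeasure_gibbsMeasure (hf.smul_add hψ r)
  have hprob := fun r : ℝ => (hG r).isProbabilityMeasure
  have herg : ∀ r : ℝ, Ergodic shift (gibbsMeasure (r • ψ + f)) := fun r => by
    obtain ⟨D, hD⟩ := (hf.smul_add hψ r).exists_distortion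
    exact (hG r).ergodic hD
  obtain ⟨D, hD⟩ := hf.exists_distortion
  obtain ⟨E, hE⟩ := hψ.exists_distortion
  have hb := fun r : ℝ => weightBounds_gibbsMeasure (hf.smul_add hψ r) (hD.smul_add hE r)
  -- With equal pressures, the weight at u is at most the geometric mean of those at s and t, hence
  -- at most their sum. This is the source of μ_u ≪ μ_s + μ_t.
  have hw : ∀ (n : ℕ) (ω : Fin n → I),
      weight (u • ψ + f) ω ≤ weight (s • ψ + f) ω + weight (t • ψ + f) ω := by
    intro n ω
    have hsup : supSum (u • ψ + f) ω ≤
        (supSum (s • ψ + f) ω + supSum (t • ψ + f) ω) / 2 := by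
      refine supSum_le_of_forall fun x hx => ?_
      have h7 := birkhoffSum_le_supSum (hD.smul_add hE s) hx
      have h8 := birkhoffSum_le_supSum (hD.smul_add hE t) hx
      rw [birkhoffSum_smul_add] at h7 h8 ⊢
      rw [hu]
      linarith
    unfold weight
    rw [← hps, ← hpt]
    rcases le_total (supSum (s • ψ + f) ω) (supSum (t • ψ + f) ω) with h | h
    · exact (Real.exp_le_exp.2 (by linarith)).trans (le_add_of_nonneg_left (Real.exp_pos _).le)
    · exact (Real.exp_le_exp.2 (by linarith)).trans (le_add_of_nonneg_right (Real.exp_pos _).le)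
  set c := fun r : ℝ => Real.exp (3 * (|r| * E + D)) with hc
  have hc0 : ∀ r, 0 < c r := fun r => Real.exp_pos _
  have hac : gibbsMeasure (u • ψ + f) ≪
      gibbsMeasure (s • ψ + f) + gibbsMeasure (t • ψ + f) := by
    refine absolutelyContinuous_of_cylinder (C := c u * (c s + c t))
      (mul_pos (hc0 u) (add_pos (hc0 s) (hc0 t))).le fun n ω => ?_
    rw [measureReal_add_apply, mul_assoc]
    refine (hb u n ω).2.trans (mul_le_mul_of_nonneg_left ((hw n ω).trans ?_) (hc0 u).le)
    have h7 := (hb s n ω).1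
    have h8 := (hb t n ω).1
    have h9 : 0 ≤ c t * (gibbsMeasure (s • ψ + f)).real (cylinder ω) :=
      mul_nonneg (hc0 t).le measureReal_nonneg
    have h10 : 0 ≤ c s * (gibbsMeasure (t • ψ + f)).real (cylinder ω) :=
      mul_nonneg (hc0 s).le measureReal_nonneg
    rw [add_mul, mul_add, mul_add]
    linarith
  rcases eq_or_mutuallySingular_of_ergodic (herg u) (herg s) with h | hsing
  · exact gibbsMeasure_ne hf hψ h0 hus hps h
  rcases eq_or_mutuallySingular_of_ergodic (herg u) (herg t) with h | hsing'
  · exact gibbsMeasure_ne hf hψ h0 hut hpt h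
  have hz := Measure.eq_zero_of_absolutelyContinuous_of_mutuallySingular hac
    (hsing.add_right hsing')
  exact IsProbabilityMeasure.ne_zero (gibbsMeasure (u • ψ + f)) hz

end Uniqueness

/-! ### Large deviations and recurrence of Birkhoff sums -/

/-- The set of points `x` such that `S_ω ψ ∈ J` for the word `ω` of the first `n` symbols. -/
def visitSet (ψ : (ℕ → I) → ℝ) (J : Set ℝ) (n : ℕ) : Set (ℕ → I) :=
  prefixWord n ⁻¹' {ω | supSum ψ ω ∈ J}

theorem mem_visitSet {ψ : (ℕ → I) → ℝ} {J : Set ℝ} {n : ℕ} {x : ℕ → I} :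
    x ∈ visitSet ψ J n ↔ supSum ψ (prefixWord n x) ∈ J := Iff.rfl

section Recurrence

variable [Fintype I] [Nonempty I] [MeasurableSpace I] [DiscreteMeasurableSpace I]
  {f ψ : (ℕ → I) → ℝ}

theorem measurableSet_visitSet (ψ : (ℕ → I) → ℝ) (J : Set ℝ) (n : ℕ) :
    MeasurableSet (visitSet ψ J n) := measurableSet_prefixWord_preimage n _

/-- Exponential Chebyshev bound: on the event, the weight for tψ+f is at most a constant times
e^{−a} times the weight for (t+u)ψ+f, corrected by the difference of pressures. -/
theorem exists_measureReal_deviation_le (hf : IsHolder f) (hψ : IsHolder ψ) (t u : ℝ) :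
    ∃ C : ℝ, ∀ (n : ℕ) (a : ℝ),
      (gibbsMeasure (t • ψ + f)).real (visitSet ψ {y | a ≤ u * y} n) ≤
        C * Real.exp (n * (pressure ((t + u) • ψ + f) - pressure (t • ψ + f)) - a) := by
  classical
  have _ := (isGibbsMeasure_gibbsMeasure (hf.smul_add hψ t)).isProbabilityMeasure
  obtain ⟨D, hD⟩ := hf.exists_distortion
  obtain ⟨E, hE⟩ := hψ.exists_distortion
  have hb := weightBounds_gibbsMeasure (hf.smul_add hψ t) (hD.smul_add hE t)
  set c := Real.exp (3 * (|t| * E + D))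
  set A := (2 * (|t| * E) + D) + (2 * (|t + u| * E) + D) with hA
  refine ⟨c * Real.exp A * Real.exp (|t + u| * E + D), fun n a => ?_⟩
  set q := Real.exp (n * (pressure ((t + u) • ψ + f) - pressure (t • ψ + f)) - a) with hq
  rw [visitSet, measureReal_prefixWord_preimage]
  have hterm : ∀ ω ∈ Finset.univ.filter
      fun ω : Fin n → I => ω ∈ {ω : Fin n → I | supSum ψ ω ∈ {y | a ≤ u * y}},
      (gibbsMeasure (t • ψ + f)).real (cylinder ω) ≤
        c * Real.exp A * q * weight ((t + u) • ψ + f) ω := by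
    intro ω hω
    have hω' : a ≤ u * supSum ψ ω := (Finset.mem_filter.1 hω).2
    refine (hb n ω).2.trans ?_
    rw [mul_assoc, mul_assoc]
    refine mul_le_mul_of_nonneg_left ?_ (Real.exp_pos _).le
    rw [weight, weight, hq, ← Real.exp_add, ← Real.exp_add, Real.exp_le_exp]
    have h1 := abs_le.1 (abs_supSum_smul_add_sub_le hD hE t ω)
    have h2 := abs_le.1 (abs_supSum_smul_add_sub_le hD hE (t + u) ω)
    linarith
  refine (Finset.sum_le_sum hterm).trans ((Finset.sum_le_univ_sum_of_nonneg fun ω => ?_).trans ?_)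
  · exact mul_nonneg (by positivity) (weight_pos ω).le
  rw [← Finset.mul_sum]
  refine (mul_le_mul_of_nonneg_left (sum_weight_le (hf.smul_add hψ (t + u))
    (hD.smul_add hE (t + u)) n) (by positivity)).trans_eq (by ring)

/-- A weak law of large numbers. The subgradient inequality at t+u gives P(t+u) − P(t) ≤ u∫ψ
dμ_{t+u}, and continuity of the integral makes this smaller than |u|η for small u, so both tails
decay exponentially. -/
theorem eventually_measureReal_visitSet_ge (hf : IsHolder f) (hψ : IsHolder ψ) {t : ℝ}
    (ht : ∫ x, ψ x ∂gibbsMeasure (t • ψ + f) = 0) {η : ℝ} (hη : 0 < η) :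
    ∀ᶠ n : ℕ in atTop,
      1 / 2 ≤ (gibbsMeasure (t • ψ + f)).real (visitSet ψ {y | |y| ≤ η * n} n) := by
  have _ := (isGibbsMeasure_gibbsMeasure (hf.smul_add hψ t)).isProbabilityMeasure
  set μ := gibbsMeasure (t • ψ + f) with hμ
  have hcont := (continuous_integral_gibbsMeasure hf hψ).tendsto t
  rw [ht, Metric.tendsto_nhds] at hcont
  obtain ⟨δ, hδ, hball⟩ := Metric.eventually_nhds_iff.1 (hcont η hη)
  have hdev : ∀ u : ℝ, |u| = δ / 2 → ∀ᶠ n : ℕ in atTop,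
      μ.real (visitSet ψ {y | δ / 2 * η * n ≤ u * y} n) ≤ 1 / 4 := by
    intro u hu
    obtain ⟨C, hC⟩ := exists_measureReal_deviation_le hf hψ t u
    have h1 := hball (y := t + u) (by simp [hu]; linarith)
    rw [Real.dist_eq, sub_zero] at h1
    have h2 := pressure_add_mul_integral_le hf hψ t (t + u)
    set m := ∫ x, ψ x ∂gibbsMeasure ((t + u) • ψ + f)
    have h3 : u * m < δ / 2 * η := by
      refine (le_abs_self _).trans_lt ?_
      rw [abs_mul, hu]
      exact mul_lt_mul_of_pos_left h1 (by positivity)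
    set r := pressure ((t + u) • ψ + f) - pressure (t • ψ + f) - δ / 2 * η with hr
    have hr0 : r < 0 := by
      have : (t - (t + u)) * m = -(u * m) := by ring
      linarith
    have hlim : Tendsto (fun n : ℕ => C * Real.exp r ^ n) atTop (𝓝 0) := by
      simpa using (tendsto_pow_atTop_nhds_zero_of_lt_one (Real.exp_pos r).le
        (by simpa using hr0)).const_mul C
    filter_upwards [hlim.eventually (gt_mem_nhds (by norm_num : (0 : ℝ) < 1 / 4))] with n hn
    refine (hC n _).trans (le_of_eq_of_le ?_ hn.le)
    rw [← Real.exp_nat_mul, hr]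
    ring_nf
  have hpos := hdev (δ / 2) (abs_of_pos (by positivity))
  have hneg := hdev (-(δ / 2)) (by rw [abs_neg, abs_of_pos (by positivity)])
  filter_upwards [hpos, hneg] with n h1 h2
  have hsub : (visitSet ψ {y | |y| ≤ η * n} n)ᶜ ⊆
      visitSet ψ {y | δ / 2 * η * n ≤ δ / 2 * y} n ∪
        visitSet ψ {y | δ / 2 * η * n ≤ -(δ / 2) * y} n := by
    intro x hx
    have hx' : η * n < |supSum ψ (prefixWord n x)| := not_le.1 hx
    rcases lt_abs.1 hx' with h | h
    · left
      have := mul_le_mul_of_nonneg_left h.le (by positivity : 0 ≤ δ / 2)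
      change δ / 2 * η * n ≤ δ / 2 * supSum ψ (prefixWord n x)
      linarith
    · right
      have := mul_le_mul_of_nonneg_left h.le (by positivity : 0 ≤ δ / 2)
      change δ / 2 * η * n ≤ -(δ / 2) * supSum ψ (prefixWord n x)
      linarith
  have h3 := (measureReal_mono hsub (measure_ne_top μ _)).trans (measureReal_union_le _ _)
  rw [probReal_compl_eq_one_sub (measurableSet_visitSet _ _ _)] at h3
  linarith

theorem WeightBounds.measure_prefixWord_preimage_inter_le {g : (ℕ → I) → ℝ} {c D : ℝ}
    {μ : Measure (ℕ → I)} [IsFiniteMeasure μ] (hc : 0 < c) (h : WeightBounds g c μ)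
    (hD : IsDistortionConst g D) {n : ℕ} (S : Set (Fin n → I)) {B : Set (ℕ → I)}
    (hB : MeasurableSet B) :
    μ (prefixWord n ⁻¹' S ∩ shift^[n] ⁻¹' B) ≤
      ENNReal.ofReal (c ^ 3) * (μ (prefixWord n ⁻¹' S) * μ B) := by
  classical
  rw [← ofReal_measureReal (measure_ne_top _ _), ← ofReal_measureReal (measure_ne_top _ _),
    ← ofReal_measureReal (measure_ne_top _ B), ← ENNReal.ofReal_mul measureReal_nonneg,
    ← ENNReal.ofReal_mul (by positivity)]
  refine ENNReal.ofReal_le_ofReal ?_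
  rw [← measureReal_restrict_apply (measurableSet_prefixWord_preimage n S),
    measureReal_prefixWord_preimage, measureReal_prefixWord_preimage, Finset.sum_mul,
    Finset.mul_sum]
  refine Finset.sum_le_sum fun ω _ => ?_
  rw [measureReal_restrict_apply (measurableSet_cylinder ω), ← mul_assoc]
  exact h.measureReal_cylinder_inter_le hc hD ω hB

theorem tsum_eq_tsum_add {u : ℕ → ENNReal} {k : ℕ} (h : ∀ n < k, u n = 0) :
    ∑' n, u n = ∑' r, u (k + r) := by
  rw [← ENNReal.summable.sum_add_tsum_nat_add' (k := k),
    Finset.sum_eq_zero fun n hn => h n (Finset.mem_range.1 hn), zero_add]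
  simp_rw [add_comm k]

/-- Decompose by the first visit time k: by quasi-independence the visits after time k cost at most
c³ times the expected number of near-zero values of a fresh sum. The bound is uniform in the
position a. -/
theorem tsum_measure_visitSet_Ico_le {g : (ℕ → I) → ℝ} {c D E K : ℝ}
    {μ : Measure (ℕ → I)} [IsProbabilityMeasure μ] (hc : 0 < c) (h : WeightBounds g c μ)
    (hD : IsDistortionConst g D) (hE : IsDistortionConst ψ E) (a : ℝ) :
    ∑' n, μ (visitSet ψ (Set.Ico a (a + (K - E))) n) ≤
      ENNReal.ofReal (c ^ 3) * ∑' n, μ (visitSet ψ {y | |y| ≤ K} n) := by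
  classical
  set A := visitSet ψ (Set.Ico a (a + (K - E))) with hA
  set R := visitSet ψ {y | |y| ≤ K} with hR
  have hAm : ∀ n, MeasurableSet (A n) := measurableSet_visitSet _ _
  -- `disjointed A k` is the event that the first visit occurs at time k; it depends only on the
  -- first k symbols.
  have hprefix : ∀ k, ∃ S : Set (Fin k → I), disjointed A k = prefixWord k ⁻¹' S := by
    intro k
    refine ⟨prefixWord k '' disjointed A k, (Set.subset_preimage_image _ _).antisymm ?_⟩
    rintro x ⟨y, hy, hyx⟩
    have hj : ∀ j ≤ k, prefixWord j y = prefixWord j x := fun j hjk =>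
      funext fun i => congrFun hyx ⟨i, i.2.trans_le hjk⟩
    rw [disjointed_eq_inter_compl] at hy ⊢
    simp only [Set.mem_inter_iff, Set.mem_iInter, Set.mem_compl_iff, hA, mem_visitSet] at hy ⊢
    exact ⟨hj k le_rfl ▸ hy.1, fun j hjk => hj j hjk.le ▸ hy.2 j hjk⟩
  have hstep : ∀ k r, μ (A (k + r) ∩ disjointed A k) ≤
      ENNReal.ofReal (c ^ 3) * (μ (disjointed A k) * μ (R r)) := by
    intro k r
    obtain ⟨S, hS⟩ := hprefix k
    -- Two values in an interval of length K − E differ by less than K − E, and splitting the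
    -- supremum at time k costs at most E; hence the choice of interval length.
    have hsub : A (k + r) ∩ disjointed A k ⊆ disjointed A k ∩ shift^[k] ⁻¹' R r := by
      rintro x ⟨hx1, hx2⟩
      refine ⟨hx2, ?_⟩
      have hx3 : x ∈ A k := disjointed_subset A k hx2
      rw [hA, mem_visitSet] at hx1 hx3
      rw [prefixWord_add] at hx1
      have h1 := supSum_append_le' hE (prefixWord k x) (prefixWord r (shift^[k] x))
      have h2 := le_supSum_append hE (prefixWord k x) (prefixWord r (shift^[k] x))
      have hE0 := hE.nonneg
      obtain ⟨h3, h4⟩ := hx1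
      obtain ⟨h5, h6⟩ := hx3
      change |supSum ψ (prefixWord r (shift^[k] x))| ≤ K
      exact abs_le.2 ⟨by linarith, by linarith⟩
    refine (measure_mono hsub).trans ?_
    rw [hS]
    exact h.measure_prefixWord_preimage_inter_le hc hD S (measurableSet_visitSet _ _ _)
  have hdisj : ∀ k n, n < k → A n ∩ disjointed A k = ∅ := by
    intro k n hnk
    rw [disjointed_eq_inter_compl]
    refine Set.eq_empty_of_forall_notMem fun x hx => ?_
    exact Set.mem_iInter₂.1 hx.2.2 n hnk hx.1
  calc ∑' n, μ (A n) ≤ ∑' n, ∑' k, μ (A n ∩ disjointed A k) := by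
        refine ENNReal.tsum_le_tsum fun n => ?_
        refine (measure_mono fun x hx => ?_).trans (measure_iUnion_le _)
        rw [← Set.inter_iUnion, iUnion_disjointed]
        exact ⟨hx, Set.mem_iUnion.2 ⟨n, hx⟩⟩
    _ = ∑' k, ∑' n, μ (A n ∩ disjointed A k) := ENNReal.tsum_comm
    _ ≤ ∑' k, ENNReal.ofReal (c ^ 3) * (μ (disjointed A k) * ∑' r, μ (R r)) := by
        refine ENNReal.tsum_le_tsum fun k => ?_
        rw [tsum_eq_tsum_add (k := k) fun n hn => by rw [hdisj k n hn, measure_empty],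
          ← ENNReal.tsum_mul_left, ← ENNReal.tsum_mul_left]
        exact ENNReal.tsum_le_tsum fun r => hstep k r
    _ = ENNReal.ofReal (c ^ 3) * ((∑' k, μ (disjointed A k)) * ∑' r, μ (R r)) := by
        rw [ENNReal.tsum_mul_left, ENNReal.tsum_mul_right]
    _ ≤ ENNReal.ofReal (c ^ 3) * (1 * ∑' r, μ (R r)) := by
        gcongr
        rw [← measure_iUnion (disjoint_disjointed A) fun k => MeasurableSet.disjointed hAm k]
        exact prob_le_one
    _ = _ := by rw [one_mul]

theorem sum_measureReal_visitSet_le {μ : Measure (ℕ → I)} [IsProbabilityMeasure μ] {δ Q : ℝ}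
    (hδ : 0 < δ)
    (hQ : ∀ (a : ℝ) (N : ℕ),
      ∑ n ∈ Finset.range N, μ.real (visitSet ψ (Set.Ico a (a + δ)) n) ≤ Q)
    {R : ℝ} (hR : 0 ≤ R) (N : ℕ) :
    ∑ n ∈ Finset.range N, μ.real (visitSet ψ {y | |y| ≤ R} n) ≤ (2 * R / δ + 1) * Q := by
  set q := ⌊2 * R / δ⌋₊ + 1 with hq
  have hQ0 : 0 ≤ Q := by simpa using hQ 0 0
  have hcover : ∀ n, visitSet ψ {y | |y| ≤ R} n ⊆
      ⋃ j ∈ Finset.range q, visitSet ψ (Set.Ico (-R + j * δ) (-R + j * δ + δ)) n := by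
    intro n x hx
    obtain ⟨h1, h2⟩ := abs_le.1 (show |supSum ψ (prefixWord n x)| ≤ R from hx)
    set y := supSum ψ (prefixWord n x) with hy
    have hyR : 0 ≤ (y + R) / δ := div_nonneg (by linarith) hδ.le
    have hfl := Nat.floor_le hyR
    have hlt := Nat.lt_floor_add_one ((y + R) / δ)
    rw [le_div_iff₀ hδ] at hfl
    rw [div_lt_iff₀ hδ, add_mul, one_mul] at hlt
    simp only [Set.mem_iUnion, Finset.mem_range, mem_visitSet, Set.mem_Ico, exists_prop, ← hy]
    refine ⟨⌊(y + R) / δ⌋₊, Nat.lt_succ_of_le (Nat.floor_le_floor ?_), by linarith,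
      by linarith⟩
    exact div_le_div_of_nonneg_right (by linarith) hδ.le
  calc ∑ n ∈ Finset.range N, μ.real (visitSet ψ {y | |y| ≤ R} n)
      ≤ ∑ n ∈ Finset.range N, ∑ j ∈ Finset.range q,
          μ.real (visitSet ψ (Set.Ico (-R + j * δ) (-R + j * δ + δ)) n) :=
        Finset.sum_le_sum fun n _ => (measureReal_mono (hcover n) (measure_ne_top _ _)).trans
          (measureReal_biUnion_finset_le _ _)
    _ = ∑ j ∈ Finset.range q, ∑ n ∈ Finset.range N,
          μ.real (visitSet ψ (Set.Ico (-R + j * δ) (-R + j * δ + δ)) n) := Finset.sum_comm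
    _ ≤ ∑ j ∈ Finset.range q, Q := Finset.sum_le_sum fun j _ => hQ _ _
    _ = q * Q := by simp
    _ ≤ (2 * R / δ + 1) * Q := by
        refine mul_le_mul_of_nonneg_right ?_ hQ0
        rw [hq]
        push_cast
        linarith [Nat.floor_le (show 0 ≤ 2 * R / δ by positivity)]

/-- Recurrence of mean-zero Birkhoff sums: bounded expected visits to short intervals are
incompatible with S_n ψ = o(n) in probability. -/
theorem tsum_measure_visitSet_eq_top (hf : IsHolder f) (hψ : IsHolder ψ) {t : ℝ}
    (ht : ∫ x, ψ x ∂gibbsMeasure (t • ψ + f) = 0) {E K : ℝ} (hE : IsDistortionConst ψ E)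
    (hK : E < K) :
    ∑' n, gibbsMeasure (t • ψ + f) (visitSet ψ {y | |y| ≤ K} n) = ⊤ := by
  by_contra htop
  have _ := (isGibbsMeasure_gibbsMeasure (hf.smul_add hψ t)).isProbabilityMeasure
  obtain ⟨D, hD⟩ := (hf.smul_add hψ t).exists_distortion
  have hb := weightBounds_gibbsMeasure (hf.smul_add hψ t) hD
  set μ := gibbsMeasure (t • ψ + f) with hμ
  set T := ENNReal.ofReal (Real.exp (3 * D) ^ 3) *
    ∑' n, μ (visitSet ψ {y | |y| ≤ K} n) with hT
  have hTtop : T ≠ ⊤ := ENNReal.mul_ne_top ENNReal.ofReal_ne_top htop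
  set Q := T.toReal with hQdef
  have hQ0 : 0 ≤ Q := ENNReal.toReal_nonneg
  set δ := K - E with hδdef
  have hδ : 0 < δ := sub_pos.2 hK
  have hQ : ∀ (a : ℝ) (N : ℕ),
      ∑ n ∈ Finset.range N, μ.real (visitSet ψ (Set.Ico a (a + δ)) n) ≤ Q := by
    intro a N
    rw [hQdef]
    simp only [Measure.real]
    rw [← ENNReal.toReal_sum fun n _ => measure_ne_top _ _]
    refine ENNReal.toReal_mono hTtop ((ENNReal.sum_le_tsum _).trans ?_)
    exact tsum_measure_visitSet_Ico_le (Real.exp_pos _) hb hD hE a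
  -- Chosen so that covering [−ηN, ηN] by intervals of length δ allows at most N/4 + Q expected
  -- visits, against the (N − N₀)/2 forced by the weak law.
  set η := δ / (8 * (Q + 1)) with hη
  have hη0 : 0 < η := by positivity
  obtain ⟨N₀, hN₀⟩ := eventually_atTop.1 (eventually_measureReal_visitSet_ge hf hψ ht hη0)
  have hlow : ∀ N : ℕ, ((N : ℝ) - N₀) / 2 ≤
      ∑ n ∈ Finset.range N, μ.real (visitSet ψ {y | |y| ≤ η * n} n) := by
    intro N
    induction N with
    | zero =>
      rw [Finset.sum_range_zero]
      push_cast
      linarith [(N₀.cast_nonneg : (0 : ℝ) ≤ N₀)]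
    | succ N ih =>
      rcases lt_or_ge N N₀ with h | h
      · refine le_trans ?_ (Finset.sum_nonneg fun n _ => measureReal_nonneg)
        have : ((N + 1 : ℕ) : ℝ) ≤ N₀ := by exact_mod_cast h
        linarith
      · rw [Finset.sum_range_succ]
        push_cast
        linarith [hN₀ N h]
  have hup : ∀ N : ℕ, ((N : ℝ) - N₀) / 2 ≤ N / 4 + Q := by
    intro N
    have h1 := sum_measureReal_visitSet_le hδ hQ (mul_nonneg hη0.le N.cast_nonneg) N
    have h2 : ∑ n ∈ Finset.range N, μ.real (visitSet ψ {y | |y| ≤ η * n} n) ≤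
        ∑ n ∈ Finset.range N, μ.real (visitSet ψ {y | |y| ≤ η * N} n) := by
      refine Finset.sum_le_sum fun n hn => measureReal_mono (fun x hx => ?_) (measure_ne_top _ _)
      have hn' : (n : ℝ) ≤ N := by exact_mod_cast (Finset.mem_range.1 hn).le
      exact (show |supSum ψ (prefixWord n x)| ≤ η * n from hx).trans
        (mul_le_mul_of_nonneg_left hn' hη0.le)
    have h3 : 2 * (η * N) / δ * Q ≤ N / 4 := by
      have : 2 * (η * N) / δ * Q = N / 4 * (Q / (Q + 1)) := by
        rw [hη]; field_simp; ring
      rw [this]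
      exact mul_le_of_le_one_right (by positivity)
        ((div_le_one (by positivity)).2 (by linarith))
    linarith [hlow N]
  obtain ⟨N, hN⟩ := exists_nat_gt (2 * (N₀ : ℝ) + 4 * Q)
  linarith [hup N]

end Recurrence

/-! ### Exponential growth of extended nonnegative sequences -/

theorem log_div_le_coe_iff {z : ENNReal} {n : ℕ} (hn : 0 < n) {r : ℝ} :
    ENNReal.log z / (n : EReal) ≤ (r : EReal) ↔ z ≤ ENNReal.ofReal (Real.exp (n * r)) := by
  rw [← EReal.coe_coe_eq_natCast, EReal.div_le_iff_le_mul (by exact_mod_cast hn)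
    (EReal.coe_ne_top _), ← EReal.coe_mul, ← ENNReal.log_le_log_iff,
    ENNReal.log_ofReal_of_pos (Real.exp_pos _), Real.log_exp]

theorem limsup_log_div_le {u : ℕ → ENNReal} {C P : ℝ}
    (h : ∀ n, u n ≤ ENNReal.ofReal (Real.exp (C + n * P))) :
    limsup (fun n : ℕ => ENNReal.log (u n) / (n : EReal)) atTop ≤ P := by
  have hlim : Tendsto (fun n : ℕ => ((C / n + P : ℝ) : EReal)) atTop (𝓝 (P : EReal)) := by
    refine (continuous_coe_real_ereal.tendsto P).comp ?_
    simpa using (tendsto_const_div_atTop_nhds_zero_nat C).add_const P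
  rw [← hlim.limsup_eq]
  refine limsup_le_limsup ?_
  filter_upwards [eventually_gt_atTop 0] with n hn
  have hn' : (0 : ℝ) < n := by exact_mod_cast hn
  rw [log_div_le_coe_iff hn]
  refine (h n).trans_eq ?_
  congr 2
  field_simp

/-- Root test: a growth rate below P would dominate the tail by a convergent geometric series.
Finiteness of each term is needed for the initial segment. -/
theorem le_limsup_log_div {u : ℕ → ENNReal} (hu : ∀ n, u n ≠ ⊤) {P : ℝ}
    (h : ∑' n, u n * ENNReal.ofReal (Real.exp (-(n * P))) = ⊤) :
    (P : EReal) ≤ limsup (fun n : ℕ => ENNReal.log (u n) / (n : EReal)) atTop := by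
  by_contra! hlt
  obtain ⟨r, hr1, hr2⟩ := EReal.lt_iff_exists_real_btwn.1 hlt
  have hrP : r < P := EReal.coe_lt_coe_iff.1 hr2
  obtain ⟨N, hN⟩ := eventually_atTop.1
    ((eventually_lt_of_limsup_lt hr1).and (eventually_gt_atTop 0))
  have hterm : ∀ n, u (n + N) * ENNReal.ofReal (Real.exp (-((n + N : ℕ) * P))) ≤
      ENNReal.ofReal (Real.exp (r - P)) ^ n := by
    intro n
    obtain ⟨h1, h2⟩ := hN (n + N) (Nat.le_add_left N n)
    have h3 := (log_div_le_coe_iff h2).1 h1.le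
    refine (mul_le_mul_left h3 _).trans ?_
    rw [← ENNReal.ofReal_mul (Real.exp_pos _).le, ← Real.exp_add,
      ← ENNReal.ofReal_pow (Real.exp_pos _).le, ← Real.exp_nat_mul]
    refine ENNReal.ofReal_le_ofReal (Real.exp_le_exp.2 ?_)
    push_cast
    nlinarith [(N.cast_nonneg : (0 : ℝ) ≤ N)]
  have hgeo : ∑' n : ℕ, ENNReal.ofReal (Real.exp (r - P)) ^ n ≠ ⊤ := by
    rw [ENNReal.tsum_geometric]
    refine ENNReal.inv_ne_top.2 (tsub_pos_of_lt ?_).ne'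
    rw [← ENNReal.ofReal_one]
    exact (ENNReal.ofReal_lt_ofReal_iff one_pos).2 (by simpa using hrP)
  refine absurd h ?_
  rw [← ENNReal.summable.sum_add_tsum_nat_add' (k := N)]
  refine ENNReal.add_ne_top.2 ⟨ENNReal.sum_ne_top.2 fun n _ =>
    ENNReal.mul_ne_top (hu n) ENNReal.ofReal_ne_top, ?_⟩
  exact ne_top_of_le_ne_top hgeo (ENNReal.tsum_le_tsum hterm)

/-! ### Bounds for the fibre-induced pressure -/

section Fibre

variable [Fintype I] [Nonempty I] {f ψ : (ℕ → I) → ℝ} {K : ℝ}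

open Classical in
theorem zetaSum_eq_ofReal (f ψ : (ℕ → I) → ℝ) (K : ℝ) (n : ℕ) :
    zetaSum f ψ K n =
      ENNReal.ofReal (∑ ω : Fin n → I with |supSum ψ ω| ≤ K, Real.exp (supSum f ω)) := by
  rw [zetaSum, ENNReal.ofReal_sum_of_nonneg fun ω _ => (Real.exp_pos _).le]

/-- On the admissible words the term s·S_ω ψ is at most |s|K in absolute value, so tilting by sψ
changes the sum only by a bounded factor. -/
theorem fibrePressureAt_le_pressure (hf : IsHolder f) (hψ : IsHolder ψ) (s : ℝ) :
    fibrePressureAt f ψ K ≤ (pressure (s • ψ + f) : EReal) := by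
  classical
  obtain ⟨D, hD⟩ := hf.exists_distortion
  obtain ⟨E, hE⟩ := hψ.exists_distortion
  refine limsup_log_div_le (C := 2 * (|s| * E) + D + |s| * K + (|s| * E + D)) fun n => ?_
  rw [zetaSum_eq_ofReal]
  refine ENNReal.ofReal_le_ofReal ?_
  rw [add_assoc, Real.exp_add]
  refine le_trans ?_ (mul_le_mul_of_nonneg_left
    (partitionSum_le_exp (hf.smul_add hψ s) (hD.smul_add hE s) n) (Real.exp_pos _).le)
  rw [partitionSum_univ, Finset.mul_sum]
  refine (Finset.sum_le_sum fun ω hω => ?_).trans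
    (Finset.sum_le_univ_sum_of_nonneg fun ω => by positivity)
  rw [← Real.exp_add, Real.exp_le_exp]
  have h1 := abs_le.1 (abs_supSum_smul_add_sub_le hD hE s ω)
  have h2 : |s * supSum ψ ω| ≤ |s| * K := by
    rw [abs_mul]
    exact mul_le_mul_of_nonneg_left (Finset.mem_filter.1 hω).2 (abs_nonneg s)
  linarith [(abs_le.1 h2).1]

theorem le_fibrePressureAt {P : ℝ}
    (h : ∑' n, zetaSum f ψ K n * ENNReal.ofReal (Real.exp (-(n * P))) = ⊤) :
    (P : EReal) ≤ fibrePressureAt f ψ K :=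
  le_limsup_log_div (fun n => by rw [zetaSum_eq_ofReal]; exact ENNReal.ofReal_ne_top) h

theorem tsum_returnWords_eq_top {P : ℝ}
    (h : ∑' n, zetaSum f ψ K n * ENNReal.ofReal (Real.exp (-(n * P))) = ⊤) :
    ∑' w : returnWords ψ K,
      ENNReal.ofReal (Real.exp (supSum f w.1.2 - (w.1.1 : ℝ) * P)) = ⊤ := by
  classical
  rw [tsum_subtype (returnWords ψ K) fun w : (Σ n : ℕ, Fin n → I) =>
    ENNReal.ofReal (Real.exp (supSum f w.2 - (w.1 : ℝ) * P)), ENNReal.tsum_sigma']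
  -- `returnWords` excludes the empty word; the term n = 0 is finite, so dropping it does not affect
  -- divergence.
  rw [← ENNReal.summable.sum_add_tsum_nat_add' (k := 1), ENNReal.add_eq_top] at h
  rcases h with h | h
  · refine absurd h (ENNReal.sum_ne_top.2 fun n _ =>
      ENNReal.mul_ne_top ?_ ENNReal.ofReal_ne_top)
    rw [zetaSum_eq_ofReal]
    exact ENNReal.ofReal_ne_top
  rw [← ENNReal.summable.sum_add_tsum_nat_add' (k := 1), ENNReal.add_eq_top]
  right
  rw [← top_le_iff, ← h]
  refine ENNReal.tsum_le_tsum fun n => ?_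
  rw [tsum_fintype, zetaSum, Finset.sum_mul, Finset.sum_filter]
  refine Finset.sum_le_sum fun ω _ => ?_
  split_ifs with hω
  · rw [Set.indicator_of_mem (show (⟨n + 1, ω⟩ : Σ n : ℕ, Fin n → I) ∈ returnWords ψ K from
      ⟨Nat.le_add_left 1 n, hω⟩), ← ENNReal.ofReal_mul (Real.exp_pos _).le, ← Real.exp_add,
      sub_eq_add_neg]
  · exact zero_le

/-- Recurrence translated to words: the Gibbs bounds and |S_ω ψ| ≤ K compare the visit probability
at time n with ζ_n e^{−nP(t)}. -/
theorem tsum_zetaSum_eq_top [MeasurableSpace I] [DiscreteMeasurableSpace I] (hf : IsHolder f)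
    (hψ : IsHolder ψ) {t : ℝ} (ht : ∫ x, ψ x ∂gibbsMeasure (t • ψ + f) = 0) {E : ℝ}
    (hE : IsDistortionConst ψ E) (hK : E < K) :
    ∑' n, zetaSum f ψ K n * ENNReal.ofReal (Real.exp (-(n * pressure (t • ψ + f)))) = ⊤ := by
  classical
  have _ := (isGibbsMeasure_gibbsMeasure (hf.smul_add hψ t)).isProbabilityMeasure
  have htop := tsum_measure_visitSet_eq_top hf hψ ht hE hK
  obtain ⟨D, hD⟩ := hf.exists_distortion
  have hb := weightBounds_gibbsMeasure (hf.smul_add hψ t) (hD.smul_add hE t)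
  set μ := gibbsMeasure (t • ψ + f) with hμ
  set p := pressure (t • ψ + f) with hp
  set C := Real.exp (3 * (|t| * E + D)) * Real.exp (2 * (|t| * E) + D + |t| * K) with hC
  have hle : ∀ n, μ (visitSet ψ {y | |y| ≤ K} n) ≤
      ENNReal.ofReal C * (zetaSum f ψ K n * ENNReal.ofReal (Real.exp (-(n * p)))) := by
    intro n
    rw [zetaSum_eq_ofReal, ← ENNReal.ofReal_mul
      (Finset.sum_nonneg fun ω _ => (Real.exp_pos _).le),
      ← ENNReal.ofReal_mul (by positivity), ← ofReal_measureReal (measure_ne_top _ _)]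
    refine ENNReal.ofReal_le_ofReal ?_
    rw [visitSet, measureReal_prefixWord_preimage, Finset.sum_mul, Finset.mul_sum]
    refine Finset.sum_le_sum fun ω hω => (hb n ω).2.trans ?_
    have hω' : |supSum ψ ω| ≤ K := (Finset.mem_filter.1 hω).2
    rw [hC, mul_assoc]
    refine mul_le_mul_of_nonneg_left ?_ (Real.exp_pos _).le
    rw [weight, ← Real.exp_add, ← Real.exp_add, Real.exp_le_exp]
    have h1 := abs_le.1 (abs_supSum_smul_add_sub_le hD hE t ω)
    have h2 : |t * supSum ψ ω| ≤ |t| * K := by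
      rw [abs_mul]
      exact mul_le_mul_of_nonneg_left hω' (abs_nonneg t)
    linarith [(abs_le.1 h2).2]
  have h := ENNReal.tsum_le_tsum hle
  rw [htop, ENNReal.tsum_mul_left, top_le_iff, ENNReal.mul_eq_top] at h
  rcases h with h | h
  · exact h.2
  · exact absurd h.1 ENNReal.ofReal_ne_top

end Fibre

/-! ### Functions that are constant on one-cylinders -/

section ConstOnOneCylinders

variable [Fintype I] [Nonempty I] {f ψ : (ℕ → I) → ℝ} {K : ℝ}

theorem ConstOnOneCylinders.birkhoffSum_eq (hc : ConstOnOneCylinders ψ) {n : ℕ} {ω : Fin n → I}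
    {x : ℕ → I} (hx : x ∈ cylinder ω) :
    birkhoffSum shift ψ n x = ∑ k, ψ fun _ => ω k := by
  rw [birkhoffSum, Finset.sum_range]
  refine Finset.sum_congr rfl fun k _ => hc _ _ ?_
  rw [shift_iterate]
  exact hx k

theorem ConstOnOneCylinders.supSum_eq (hc : ConstOnOneCylinders ψ) {n : ℕ} (ω : Fin n → I) :
    supSum ψ ω = ∑ k, ψ fun _ => ω k := by
  have : Nonempty (cylinder ω) := (cylinder_nonempty ω).to_subtype
  unfold supSum
  simp_rw [fun x : cylinder ω => hc.birkhoffSum_eq x.2]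
  exact ciSup_const

theorem ConstOnOneCylinders.supSum_smul_add_le (hc : ConstOnOneCylinders ψ) (hf : IsHolder f)
    (s : ℝ) {n : ℕ} (ω : Fin n → I) :
    supSum (s • ψ + f) ω ≤ s * (∑ k, ψ fun _ => ω k) + supSum f ω := by
  obtain ⟨D, hD⟩ := hf.exists_distortion
  refine supSum_le_of_forall fun x hx => ?_
  rw [birkhoffSum_smul_add, hc.birkhoffSum_eq hx]
  linarith [birkhoffSum_le_supSum hD hx]

theorem ConstOnOneCylinders.mem_zeroSymbols (hc : ConstOnOneCylinders ψ) {i : I} :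
    i ∈ zeroSymbols ψ ↔ (ψ fun _ => i) = 0 :=
  ⟨fun h => h _ rfl, fun h x hx => (hc x (fun _ => i) hx).trans h⟩


end ConstOnOneCylinders

/-! ### Locally constant ψ: range of averages, boundary and exterior cases -/

section ConstOnOneCylinders

variable [Fintype I] [Nonempty I] {f ψ : (ℕ → I) → ℝ} {K : ℝ}

theorem birkhoffSum_div_mem_Icc {a b : ℝ} (ha : ∀ x, a ≤ ψ x) (hb : ∀ x, ψ x ≤ b)
    (x : ℕ → I) {n : ℕ} (hn : 0 < n) : birkhoffSum shift ψ n x / n ∈ Set.Icc a b := by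
  have hn' : (0 : ℝ) < n := by exact_mod_cast hn
  rw [Set.mem_Icc, le_div_iff₀ hn', div_le_iff₀ hn']
  unfold birkhoffSum
  constructor
  · calc a * n = ∑ _k ∈ Finset.range n, a := by simp [mul_comm]
      _ ≤ _ := Finset.sum_le_sum fun k _ => ha _
  · calc _ ≤ ∑ _k ∈ Finset.range n, b := Finset.sum_le_sum fun k _ => hb _
      _ = b * n := by simp [mul_comm]

theorem tendsto_birkhoffSum_div_const (ψ : (ℕ → I) → ℝ) (i : I) :
    Tendsto (fun n : ℕ => birkhoffSum shift ψ n (fun _ => i) / n) atTop (𝓝 (ψ fun _ => i)) := by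
  refine tendsto_const_nhds.congr' ?_
  filter_upwards [eventually_gt_atTop 0] with n hn
  have hn' : (0 : ℝ) < n := by exact_mod_cast hn
  have h : ∀ k, shift^[k] (fun _ : ℕ => i) = fun _ => i := fun k => by
    funext j
    rw [shift_iterate]
  simp [birkhoffSum, h, mul_div_cancel_left₀ _ hn'.ne']

/-- Every Birkhoff average is a mean of the values of ψ on the symbols, and the extreme value is
attained along a constant sequence. -/
theorem ConstOnOneCylinders.isLeast_lowerAvg (hc : ConstOnOneCylinders ψ) :
    IsLeast (Set.range fun i : I => ψ fun _ => i) (lowerAvg ψ) := by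
  obtain ⟨i, hi⟩ := Finite.exists_min fun i : I => ψ fun _ => i
  obtain ⟨j, hj⟩ := Finite.exists_max fun i : I => ψ fun _ => i
  have hmem := fun (x : ℕ → I) (n : ℕ) (hn : 0 < n) => birkhoffSum_div_mem_Icc (ψ := ψ)
    (a := ψ fun _ => i) (b := ψ fun _ => j)
    (fun x => (hi (x 0)).trans_eq (hc _ _ rfl))
    (fun x => (hc x (fun _ => x 0) rfl).trans_le (hj (x 0))) x hn
  have hle : ∀ x, (ψ fun _ => i) ≤
      liminf (fun n : ℕ => birkhoffSum shift ψ n x / n) atTop := fun x => by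
    refine le_liminf_of_le (IsBoundedUnder.isCoboundedUnder_ge ⟨ψ fun _ => j, ?_⟩) ?_
    · rw [eventually_map]
      exact (eventually_gt_atTop 0).mono fun n hn => (hmem x n hn).2
    · exact (eventually_gt_atTop 0).mono fun n hn => (hmem x n hn).1
  have heq : lowerAvg ψ = ψ fun _ => i := by
    refine le_antisymm (ciInf_le_of_le ⟨_, Set.forall_mem_range.2 hle⟩ (fun _ => i) ?_)
      (le_ciInf hle)
    rw [(tendsto_birkhoffSum_div_const ψ i).liminf_eq]
  exact ⟨⟨i, heq.symm⟩, by rintro _ ⟨k, rfl⟩; exact heq.trans_le (hi k)⟩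

theorem ConstOnOneCylinders.isGreatest_upperAvg (hc : ConstOnOneCylinders ψ) :
    IsGreatest (Set.range fun i : I => ψ fun _ => i) (upperAvg ψ) := by
  obtain ⟨i, hi⟩ := Finite.exists_min fun i : I => ψ fun _ => i
  obtain ⟨j, hj⟩ := Finite.exists_max fun i : I => ψ fun _ => i
  have hmem := fun (x : ℕ → I) (n : ℕ) (hn : 0 < n) => birkhoffSum_div_mem_Icc (ψ := ψ)
    (a := ψ fun _ => i) (b := ψ fun _ => j)
    (fun x => (hi (x 0)).trans_eq (hc _ _ rfl))
    (fun x => (hc x (fun _ => x 0) rfl).trans_le (hj (x 0))) x hn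
  have hle : ∀ x, limsup (fun n : ℕ => birkhoffSum shift ψ n x / n) atTop ≤
      ψ fun _ => j := fun x => by
    refine limsup_le_of_le (IsBoundedUnder.isCoboundedUnder_le ⟨ψ fun _ => i, ?_⟩) ?_
    · rw [eventually_map]
      exact (eventually_gt_atTop 0).mono fun n hn => (hmem x n hn).1
    · exact (eventually_gt_atTop 0).mono fun n hn => (hmem x n hn).2
  have heq : upperAvg ψ = ψ fun _ => j := by
    refine le_antisymm (ciSup_le hle)
      (le_ciSup_of_le ⟨_, Set.forall_mem_range.2 hle⟩ (fun _ => j) ?_)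
    rw [(tendsto_birkhoffSum_div_const ψ j).limsup_eq]
  exact ⟨⟨j, heq.symm⟩, by rintro _ ⟨k, rfl⟩; exact (hj k).trans_eq heq.symm⟩

/-- When σψ ≥ ε > 0 everywhere, tilting by −rσψ lowers the pressure by at least rε. -/
theorem ConstOnOneCylinders.iInf_pressure_eq_bot (hc : ConstOnOneCylinders ψ)
    (hf : IsHolder f) (hψ : IsHolder ψ) {σ ε : ℝ} (hε : 0 < ε)
    (hσ : ∀ i, ε ≤ σ * ψ fun _ => i) :
    ⨅ s : ℝ, (pressure (s • ψ + f) : EReal) = ⊥ := by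
  rw [EReal.eq_bot_iff_forall_lt]
  intro y
  set r : ℝ := (|pressure ((0 : ℝ) • ψ + f)| + |y| + 1) / ε with hr
  have hr0 : 0 ≤ r := by positivity
  have hrε : r * ε = |pressure ((0 : ℝ) • ψ + f)| + |y| + 1 := div_mul_cancel₀ _ hε.ne'
  refine (iInf_le _ (-(r * σ))).trans_lt (EReal.coe_lt_coe_iff.2 ?_)
  have h : pressure ((-(r * σ)) • ψ + f) ≤ pressure ((0 : ℝ) • ψ + f) + -(r * ε) := by
    refine pressure_le_add_of_forall_le (hf.smul_add hψ _) (hf.smul_add hψ _) fun x => ?_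
    have h1 : ε ≤ σ * ψ x := (hσ (x 0)).trans_eq (by rw [hc x (fun _ => x 0) rfl])
    have h2 := mul_le_mul_of_nonneg_left h1 hr0
    simp only [Pi.add_apply, Pi.smul_apply, smul_eq_mul]
    linarith
  linarith [le_abs_self (pressure ((0 : ℝ) • ψ + f)), neg_abs_le y]

/-- All words over the zero symbols have S_ω ψ = 0 and so are admissible; by subadditivity their
partition sum is at least e^{nP}, hence every term of the series is at least 1. -/
theorem tsum_zetaSum_eq_top_of_zeroSymbols (hc : ConstOnOneCylinders ψ) (hf : IsHolder f)
    (hK : 0 ≤ K) (hne : (zeroSymbols ψ).Nonempty) :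
    ∑' n, zetaSum f ψ K n *
      ENNReal.ofReal (Real.exp (-(n * pressureOn f (zeroSymbols ψ)))) = ⊤ := by
  classical
  rw [← top_le_iff, ← ENNReal.tsum_const_eq_top_of_ne_zero (α := ℕ) (one_ne_zero (α := ENNReal))]
  refine ENNReal.tsum_le_tsum fun n => ?_
  rw [zetaSum_eq_ofReal, ← ENNReal.ofReal_mul
    (Finset.sum_nonneg fun ω _ => (Real.exp_pos _).le), ENNReal.one_le_ofReal, Real.exp_neg,
    ← div_eq_mul_inv, one_le_div (Real.exp_pos _)]
  refine (exp_mul_pressureOn_le hf hne n).trans ?_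
  refine Finset.sum_le_sum_of_subset_of_nonneg (fun ω hω => ?_) fun _ _ _ => (Real.exp_pos _).le
  have hω' : ∀ k, ω k ∈ zeroSymbols ψ := (Finset.mem_filter.1 hω).2
  refine Finset.mem_filter.2 ⟨Finset.mem_univ _, ?_⟩
  rw [hc.supSum_eq, Finset.sum_eq_zero fun k _ => hc.mem_zeroSymbols.1 (hω' k), abs_zero]
  exact hK

/-- Zero-temperature limit: tilting by −rσψ with r → ∞ leaves words over the zero symbols unchanged
and suppresses the others. -/
theorem ConstOnOneCylinders.iInf_pressure_le (hc : ConstOnOneCylinders ψ)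
    (hf : IsHolder f) (hψ : IsHolder ψ) {σ : ℝ} (hσ0 : σ ≠ 0)
    (hσ : ∀ i, 0 ≤ σ * ψ fun _ => i) (hne : (zeroSymbols ψ).Nonempty) :
    ⨅ s : ℝ, (pressure (s • ψ + f) : EReal) ≤ pressureOn f (zeroSymbols ψ) := by
  classical
  refine EReal.le_of_forall_lt_iff_le.1 fun z hz => ?_
  have hz' := EReal.coe_lt_coe_iff.1 hz
  -- The length n is fixed before r → ∞, so only finitely many words are involved; this is enough
  -- because P ≤ (1/n) log Z_n for each single n ≥ 1.
  obtain ⟨n, hn, hn0⟩ := (((tendsto_pressureOn hf hne).eventually (gt_mem_nhds hz')).and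
    (eventually_gt_atTop 0)).exists
  have hn' : (0 : ℝ) < n := by exact_mod_cast hn0
  have hlim : Tendsto (fun r : ℝ => ∑ ω : Fin n → I,
      Real.exp (-(r * ∑ k, σ * ψ fun _ => ω k)) * Real.exp (supSum f ω)) atTop
      (𝓝 (partitionSum f (zeroSymbols ψ) n)) := by
    rw [partitionSum, Finset.sum_filter]
    refine tendsto_finsetSum _ fun ω _ => ?_
    have hnn : ∀ k ∈ Finset.univ, 0 ≤ σ * ψ fun _ => ω k := fun k _ => hσ (ω k)
    split_ifs with hω
    · have h0 : ∑ k, σ * ψ (fun _ => ω k) = 0 :=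
        Finset.sum_eq_zero fun k _ => by rw [hc.mem_zeroSymbols.1 (hω k), mul_zero]
      simp [h0]
    · have hpos : 0 < ∑ k, σ * ψ fun _ => ω k := by
        refine (Finset.sum_nonneg hnn).lt_of_ne' fun h0 => hω fun k => ?_
        have := (Finset.sum_eq_zero_iff_of_nonneg hnn).1 h0 k (Finset.mem_univ k)
        exact hc.mem_zeroSymbols.2 ((mul_eq_zero.1 this).resolve_left hσ0)
      have h1 := (Real.tendsto_exp_neg_atTop_nhds_zero.comp
        (tendsto_id.atTop_mul_const hpos)).mul_const (Real.exp (supSum f ω))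
      rw [zero_mul] at h1
      exact h1
  have hlt : partitionSum f (zeroSymbols ψ) n < Real.exp (n * z) := by
    rw [← Real.log_lt_iff_lt_exp (partitionSum_pos f hne n)]
    rwa [div_lt_iff₀ hn', mul_comm] at hn
  obtain ⟨r, hr⟩ := (hlim.eventually (gt_mem_nhds hlt)).exists
  refine (iInf_le _ (-(r * σ))).trans (EReal.coe_le_coe_iff.2 ?_)
  refine le_of_mul_le_mul_left ?_ hn'
  refine (mul_pressureOn_le_log (hf.smul_add hψ _) Set.univ_nonempty n).trans ?_
  rw [Real.log_le_iff_le_exp (partitionSum_pos _ Set.univ_nonempty n), partitionSum_univ]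
  refine le_trans (Finset.sum_le_sum fun ω _ => ?_) hr.le
  rw [← Real.exp_add, Real.exp_le_exp, ← Finset.mul_sum]
  refine (hc.supSum_smul_add_le hf _ ω).trans_eq ?_
  ring

theorem ConstOnOneCylinders.boundary (hc : ConstOnOneCylinders ψ)
    (hf : IsHolder f) (hψ : IsHolder ψ) (hK : 0 ≤ K)
    (h0 : lowerAvg ψ = 0 ∨ upperAvg ψ = 0) :
    (zeroSymbols ψ).Nonempty ∧
      fibrePressureAt f ψ K = (pressureOn f (zeroSymbols ψ) : EReal) ∧
      fibrePressureAt f ψ K = ⨅ s : ℝ, (pressure (s • ψ + f) : EReal) := by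
  -- The sign σ = ±1 treats both endpoints at once: σψ ≥ 0 in either case, and the extreme value 0
  -- is attained on some symbol.
  obtain ⟨hne, σ, hσ0, hσ⟩ : (zeroSymbols ψ).Nonempty ∧
      ∃ σ : ℝ, σ ≠ 0 ∧ ∀ i, 0 ≤ σ * ψ fun _ => i := by
    rcases h0 with h0 | h0
    · obtain ⟨⟨i, hi⟩, hle⟩ := hc.isLeast_lowerAvg
      refine ⟨⟨i, hc.mem_zeroSymbols.2 (hi.trans h0)⟩, 1, one_ne_zero, fun j => ?_⟩
      rw [one_mul, ← h0]
      exact hle ⟨j, rfl⟩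
    · obtain ⟨⟨i, hi⟩, hle⟩ := hc.isGreatest_upperAvg
      refine ⟨⟨i, hc.mem_zeroSymbols.2 (hi.trans h0)⟩, -1, by norm_num, fun j => ?_⟩
      have : (ψ fun _ => j) ≤ upperAvg ψ := hle ⟨j, rfl⟩
      linarith
  have h1 : fibrePressureAt f ψ K ≤ ⨅ s : ℝ, (pressure (s • ψ + f) : EReal) :=
    le_iInf fun s => fibrePressureAt_le_pressure hf hψ s
  have h2 := hc.iInf_pressure_le hf hψ hσ0 hσ hne
  have h3 := le_fibrePressureAt (tsum_zetaSum_eq_top_of_zeroSymbols hc hf hK hne)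
  exact ⟨hne, le_antisymm (h1.trans h2) h3, le_antisymm h1 (h2.trans h3)⟩

theorem ConstOnOneCylinders.iInf_pressure_eq_bot_of_notMem (hc : ConstOnOneCylinders ψ)
    (hf : IsHolder f) (hψ : IsHolder ψ) (h0 : 0 ∉ Set.Icc (lowerAvg ψ) (upperAvg ψ)) :
    ⨅ s : ℝ, (pressure (s • ψ + f) : EReal) = ⊥ := by
  rw [Set.mem_Icc, not_and_or, not_le, not_le] at h0
  rcases h0 with h0 | h0
  · exact hc.iInf_pressure_eq_bot hf hψ h0 (σ := 1) fun i => by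
      rw [one_mul]
      exact hc.isLeast_lowerAvg.2 ⟨i, rfl⟩
  · refine hc.iInf_pressure_eq_bot hf hψ (neg_pos.2 h0) (σ := -1) fun i => ?_
    have : (ψ fun _ => i) ≤ upperAvg ψ := hc.isGreatest_upperAvg.2 ⟨i, rfl⟩
    linarith

theorem mem_Ioo_or_eq_of_mem_Icc {a b : ℝ} (h : 0 ∈ Set.Icc a b) :
    0 ∈ Set.Ioo a b ∨ a = 0 ∨ b = 0 := by
  rcases h.1.eq_or_lt with h1 | h1
  · exact Or.inr (Or.inl h1)
  rcases h.2.eq_or_lt with h2 | h2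
  · exact Or.inr (Or.inr h2.symm)
  · exact Or.inl ⟨h1, h2⟩

theorem fibrePressureAt_eq_pressure [MeasurableSpace I] [DiscreteMeasurableSpace I]
    (hf : IsHolder f) (hψ : IsHolder ψ) {D : ℝ} (hD : IsDistortionConst ψ D) (hK : D < K)
    {t : ℝ} (ht : ∫ x, ψ x ∂gibbsMeasure (t • ψ + f) = 0) :
    fibrePressureAt f ψ K = (pressure (t • ψ + f) : EReal) :=
  le_antisymm (fibrePressureAt_le_pressure hf hψ t)
    (le_fibrePressureAt (tsum_zetaSum_eq_top hf hψ ht hD hK))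

theorem ConstOnOneCylinders.fibrePressureAt_eq_iInf [MeasurableSpace I]
    [DiscreteMeasurableSpace I] (hc : ConstOnOneCylinders ψ) (hf : IsHolder f)
    (hψ : IsHolder ψ) {D : ℝ} (hD : IsDistortionConst ψ D) (hK : D < K) :
    fibrePressureAt f ψ K = ⨅ s : ℝ, (pressure (s • ψ + f) : EReal) := by
  have hle : fibrePressureAt f ψ K ≤ ⨅ s : ℝ, (pressure (s • ψ + f) : EReal) :=
    le_iInf fun s => fibrePressureAt_le_pressure hf hψ s
  by_cases h0 : 0 ∈ Set.Icc (lowerAvg ψ) (upperAvg ψ)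
  · rcases mem_Ioo_or_eq_of_mem_Icc h0 with h | h
    · obtain ⟨t, ht⟩ := exists_integral_gibbsMeasure_eq_zero hf hψ h
      refine hle.antisymm ?_
      rw [fibrePressureAt_eq_pressure hf hψ hD hK ht]
      exact iInf_le _ t
    · exact (hc.boundary hf hψ (hD.nonneg.trans hK.le) h).2.2
  · rw [hc.iInf_pressure_eq_bot_of_notMem hf hψ h0] at hle ⊢
    exact le_bot_iff.1 hle

/-- At the critical exponent, the fibre-induced pressure is finite and the series diverges. -/
theorem fibrePressureAt_finite_and_divergent [MeasurableSpace I] [DiscreteMeasurableSpace I]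
    (hf : IsHolder f) (hψ : IsHolder ψ) {D : ℝ} (hD : IsDistortionConst ψ D) (hK : D < K)
    (h : 0 ∈ Set.Ioo (lowerAvg ψ) (upperAvg ψ) ∨
      (ConstOnOneCylinders ψ ∧ 0 ∈ Set.Icc (lowerAvg ψ) (upperAvg ψ))) :
    (fibrePressureAt f ψ K ≠ ⊥ ∧ fibrePressureAt f ψ K ≠ ⊤) ∧
      ∑' w : returnWords ψ K,
        ENNReal.ofReal (Real.exp (supSum f w.1.2 -
          (w.1.1 : ℝ) * (fibrePressureAt f ψ K).toReal)) = ⊤ := by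
  obtain ⟨P, hP, hdiv⟩ : ∃ P : ℝ, fibrePressureAt f ψ K = (P : EReal) ∧
      ∑' n, zetaSum f ψ K n * ENNReal.ofReal (Real.exp (-(n * P))) = ⊤ := by
    have h' : 0 ∈ Set.Ioo (lowerAvg ψ) (upperAvg ψ) ∨
        (ConstOnOneCylinders ψ ∧ (lowerAvg ψ = 0 ∨ upperAvg ψ = 0)) := by
      rcases h with h | ⟨hc, h⟩
      · exact Or.inl h
      · exact (mem_Ioo_or_eq_of_mem_Icc h).imp_right fun h => ⟨hc, h⟩
    rcases h' with h | ⟨hc, h⟩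
    · obtain ⟨t, ht⟩ := exists_integral_gibbsMeasure_eq_zero hf hψ h
      exact ⟨_, fibrePressureAt_eq_pressure hf hψ hD hK ht,
        tsum_zetaSum_eq_top hf hψ ht hD hK⟩
    · have hK0 := hD.nonneg.trans hK.le
      obtain ⟨hne, heq, -⟩ := hc.boundary (f := f) hf hψ hK0 h
      exact ⟨_, heq, tsum_zetaSum_eq_top_of_zeroSymbols hc hf hK0 hne⟩
  rw [hP, EReal.toReal_coe]
  exact ⟨⟨EReal.coe_ne_bot _, EReal.coe_ne_top _⟩, tsum_returnWords_eq_top hdiv⟩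

theorem ConstOnOneCylinders.fibrePressureAt_finite_iff [MeasurableSpace I]
    [DiscreteMeasurableSpace I] (hc : ConstOnOneCylinders ψ) (hf : IsHolder f)
    (hψ : IsHolder ψ) {D : ℝ} (hD : IsDistortionConst ψ D) (hK : D < K) :
    (fibrePressureAt f ψ K ≠ ⊥ ∧ fibrePressureAt f ψ K ≠ ⊤) ↔
      0 ∈ Set.Icc (lowerAvg ψ) (upperAvg ψ) := by
  constructor
  · rintro ⟨hbot, -⟩
    by_contra h0
    rw [hc.fibrePressureAt_eq_iInf hf hψ hD hK,
      hc.iInf_pressure_eq_bot_of_notMem hf hψ h0] at hbot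
    exact hbot rfl
  · intro h0
    exact (fibrePressureAt_finite_and_divergent hf hψ hD hK (Or.inr ⟨hc, h0⟩)).1

/-- For every level above the distortion constant the value is the same infimum, so the limit in K
is eventually constant. -/
theorem ConstOnOneCylinders.fibrePressure_eq [MeasurableSpace I]
    [DiscreteMeasurableSpace I] (hc : ConstOnOneCylinders ψ) (hf : IsHolder f)
    (hψ : IsHolder ψ) {D : ℝ} (hD : IsDistortionConst ψ D) (hK : D < K) :
    fibrePressure f ψ = fibrePressureAt f ψ K := by
  refine tendsto_nhds_unique (tendsto_fibrePressure f ψ) (tendsto_const_nhds.congr' ?_)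
  filter_upwards [eventually_gt_atTop D] with L hL
  rw [hc.fibrePressureAt_eq_iInf hf hψ hD hK, hc.fibrePressureAt_eq_iInf hf hψ hD hL]

end ConstOnOneCylinders

end FibrePressure

end

theorem mainTheorem5 {I : Type*} [Fintype I] [Nonempty I]
    [MeasurableSpace I] [DiscreteMeasurableSpace I]
    (f ψ : (ℕ → I) → ℝ)
    (hf : FibrePressure.IsHolder f) (hψ : FibrePressure.IsHolder ψ)
    (D K : ℝ) (hD : FibrePressure.IsDistortionConst ψ D) (hK : D < K) :
    -- the case where zero is an interior point
    (0 ∈ Set.Ioo (FibrePressure.lowerAvg ψ) (FibrePressure.upperAvg ψ) →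
      -- the Gibbs measures are well defined
      (∀ s : ℝ, (∃! μ : Measure (ℕ → I), FibrePressure.IsGibbsMeasure (s • ψ + f) μ) ∧
        FibrePressure.IsGibbsMeasure (s • ψ + f) (FibrePressure.gibbsMeasure (s • ψ + f))) ∧
      ∃ t : ℝ,
        (∀ s : ℝ, (∫ x, ψ x ∂(FibrePressure.gibbsMeasure (s • ψ + f))) = 0 ↔ s = t) ∧
        FibrePressure.fibrePressureAt f ψ K = (FibrePressure.pressure (t • ψ + f) : EReal) ∧
        IsLeast (Set.range fun s : ℝ => FibrePressure.pressure (s • ψ + f))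
          (FibrePressure.pressure (t • ψ + f))) ∧
    -- the case of a function that is constant on one-cylinders
    (FibrePressure.ConstOnOneCylinders ψ →
      FibrePressure.fibrePressureAt f ψ K =
        ⨅ s : ℝ, (FibrePressure.pressure (s • ψ + f) : EReal)) ∧
    (FibrePressure.ConstOnOneCylinders ψ →
      ((FibrePressure.fibrePressureAt f ψ K ≠ ⊥ ∧ FibrePressure.fibrePressureAt f ψ K ≠ ⊤) ↔
        0 ∈ Set.Icc (FibrePressure.lowerAvg ψ) (FibrePressure.upperAvg ψ)) ∧
      ((FibrePressure.fibrePressure f ψ ≠ ⊥ ∧ FibrePressure.fibrePressure f ψ ≠ ⊤) ↔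
        0 ∈ Set.Icc (FibrePressure.lowerAvg ψ) (FibrePressure.upperAvg ψ))) ∧
    (FibrePressure.ConstOnOneCylinders ψ →
      (FibrePressure.lowerAvg ψ = 0 ∨ FibrePressure.upperAvg ψ = 0) →
      (FibrePressure.zeroSymbols ψ).Nonempty ∧
      FibrePressure.fibrePressureAt f ψ K =
        (FibrePressure.pressureOn f (FibrePressure.zeroSymbols ψ) : EReal)) ∧
    -- divergence of the series at the critical exponent
    ((0 ∈ Set.Ioo (FibrePressure.lowerAvg ψ) (FibrePressure.upperAvg ψ) ∨
        (FibrePressure.ConstOnOneCylinders ψ ∧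
          0 ∈ Set.Icc (FibrePressure.lowerAvg ψ) (FibrePressure.upperAvg ψ))) →
      (FibrePressure.fibrePressureAt f ψ K ≠ ⊥ ∧ FibrePressure.fibrePressureAt f ψ K ≠ ⊤) ∧
      ∑' w : FibrePressure.returnWords ψ K,
        ENNReal.ofReal (Real.exp (FibrePressure.supSum f w.1.2 -
          (w.1.1 : ℝ) * (FibrePressure.fibrePressureAt f ψ K).toReal)) = ⊤) := by
  refine ⟨fun h0 => ⟨fun s => ?_, ?_⟩, fun hc => ?_, fun hc => ⟨?_, ?_⟩, fun hc h0 => ?_,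
    fun h => ?_⟩
  · exact ⟨FibrePressure.existsUnique_isGibbsMeasure (hf.smul_add hψ s),
      FibrePressure.isGibbsMeasure_gibbsMeasure (hf.smul_add hψ s)⟩
  · obtain ⟨t, ht⟩ := FibrePressure.exists_integral_gibbsMeasure_eq_zero hf hψ h0
    refine ⟨t, fun s => ⟨fun hs => ?_, fun hs => hs ▸ ht⟩,
      FibrePressure.fibrePressureAt_eq_pressure hf hψ hD hK ht,
      FibrePressure.isLeast_pressure hf hψ ht⟩
    exact FibrePressure.eq_of_integral_gibbsMeasure_eq_zero hf hψ h0.1.ne hs ht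
  · exact hc.fibrePressureAt_eq_iInf hf hψ hD hK
  · exact hc.fibrePressureAt_finite_iff hf hψ hD hK
  · rw [hc.fibrePressure_eq hf hψ hD hK]
    exact hc.fibrePressureAt_finite_iff hf hψ hD hK
  · obtain ⟨hne, heq, -⟩ := hc.boundary (f := f) hf hψ (hD.nonneg.trans hK.le) h0
    exact ⟨hne, heq⟩
  · exact FibrePressure.fibrePressureAt_finite_and_divergent hf hψ hD hK h
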